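/- Let $d\ge 1$, let $\Omega\subset\mathbb{R}^d$ be a nonempty bounded open set (for instance a bounded Lipschitz, locally star-shaped domain), and let $a>0$, $b\in\mathbb{R}\setminus\{0\}$. Let $\Delta$ be the Dirichlet Laplacian on $L^2(\Omega;\mathbb{R})$, i.e. $u$ is in its domain and $\Delta u=f$ if and only if $u\in H^1_0(\Omega;\mathbb{R})$, $f\in L^2(\Omega;\mathbb{R})$ and $\int_\Omega\nabla u\cdot\nabla\varphi\,dx=-\int_\Omega f\varphi\,dx$ for all $\varphi\in C_c^\infty(\Omega)$. On $L^2(\Omega;\mathbb{R}^2)$ consider the operator $$\mathcal{A}=\begin{pmatrix}a\Delta&-b\Delta\\ b\Delta&a\Delta\end{pmatrix},\qquad D(\mathcal{A})=D(\Delta)\times D(\Delta),$$ and let $B=(1,0)$, i.e. $B(z_1,z_2)^\top=z_1$. Then $\mathcal{A}$ generates exactly one strongly continuous semigroup $\{e^{\mathcal{A}t}\}_{t\ge0}$ on $L^2(\Omega;\mathbb{R}^2)$, and for every $T>0$ and every integer $m\ge1$ there exist distinct times $S_1,\dots,S_m\in(0,T)$ and $z\in L^2(\Omega;\mathbb{R}^2)\setminus\{0\}$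 such that $$Be^{\mathcal{A}S_i}z=0\qquad\text{for all } i\in\{1,\dots,m\}.$$ Moreover, these can be chosen so that $z=(v_1,v_2)^\top e$ with $v_1,v_2\in\mathbb{R}$ and $e$ an eigenfunction of $-\Delta$ for an eigenvalue $\lambda>0$, and $$S_i-S_j=(i-j)\,\frac{2\pi}{b\lambda}\qquad\text{for all } i,j\in\{1,\dots,m\},$$ and so that no interpolation observability inequality holds at these times: for all measurable sets $\omega_1,\dots,\omega_m\subset\Omega$ of positive Lebesgue measure, all $p\in[1,2]$ and all $\theta\in(0,1)$, there is no constant $C>0$ with $$\|e^{\mathcal{A}T}y\|_{L^2(\Omega;\mathbb{R}^2)}\le C\Big(\sum_{i=1}^m\|\chi_{\omega_i}Be^{\mathcal{A}S_i}y\|_{L^p(\Omega;\mathbb{R})}\Big)^{1-\theta}\|y\|_{L^2(\Omega;\mathbb{R}^2)}^{\theta}\qquad\text{for all } y\in L^2(\Omega;\mathbb{R}^2).$$ -/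

import Mathlib

open MeasureTheory Filter Topology Distributions
open scoped NNReal ENNReal

namespace StronglyCoupled

/-- `L²(Ω; ℝ)` with Lebesgue measure. -/
abbrev L2 {d : ℕ} (Ω : TopologicalSpace.Opens (EuclideanSpace ℝ (Fin d))) : Type :=
  Lp ℝ 2 ((volume : Measure (EuclideanSpace ℝ (Fin d))).restrict Ω)

/-- `L²(Ω; ℝ^d)`, the space of square integrable vector fields on `Ω`. -/
abbrev L2Field {d : ℕ} (Ω : TopologicalSpace.Opens (EuclideanSpace ℝ (Fin d))) : Type :=
  Lp (EuclideanSpace ℝ (Fin d)) 2 ((volume : Measure (EuclideanSpace ℝ (Fin d))).restrict Ω)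

/-- The state space `L²(Ω; ℝ²)`: pairs `(z₁, z₂)` of functions in `L²(Ω; ℝ)` with the Hilbert norm
`(‖z₁‖² + ‖z₂‖²)^(1/2)`. -/
abbrev State {d : ℕ} (Ω : TopologicalSpace.Opens (EuclideanSpace ℝ (Fin d))) : Type :=
  WithLp 2 (L2 Ω × L2 Ω)

/-- The state `(z₁, z₂)`. -/
def mkState {d : ℕ} {Ω : TopologicalSpace.Opens (EuclideanSpace ℝ (Fin d))}
    (z₁ z₂ : L2 Ω) : State Ω :=
  WithLp.toLp 2 (z₁, z₂)

/-- The set of pairs `(φ, ∇φ)` with `φ` a smooth function compactly supported in `Ω`, as elements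
of `L²(Ω; ℝ) × L²(Ω; ℝ^d)`. -/
def testGraph {d : ℕ} (Ω : TopologicalSpace.Opens (EuclideanSpace ℝ (Fin d))) :
    Set (L2 Ω × L2Field Ω) :=
  {q | ∃ φ : 𝓓(Ω, ℝ),
    q.1 =ᵐ[volume.restrict (Ω : Set (EuclideanSpace ℝ (Fin d)))] φ ∧
    q.2 =ᵐ[volume.restrict (Ω : Set (EuclideanSpace ℝ (Fin d)))] gradient φ}

/-- `u ∈ H¹₀(Ω; ℝ)` with weak gradient `g`: the pair `(u, g)` is a limit in `L²` of pairs
`(φ, ∇φ)` of test functions and their gradients, so `u` is an `H¹`-limit of test functions. -/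
def IsH10WithGradient {d : ℕ} (Ω : TopologicalSpace.Opens (EuclideanSpace ℝ (Fin d)))
    (u : L2 Ω) (g : L2Field Ω) : Prop :=
  (u, g) ∈ closure (testGraph Ω)

/-- The graph of the Dirichlet Laplacian on `L²(Ω; ℝ)`: `u ∈ H¹₀(Ω; ℝ)`, and `Δu = f ∈ L²(Ω; ℝ)`
in the weak sense, `∫_Ω ∇u · ∇φ = - ∫_Ω f φ` for every test function `φ`. -/
def HasDirichletLaplacian {d : ℕ} (Ω : TopologicalSpace.Opens (EuclideanSpace ℝ (Fin d)))
    (u f : L2 Ω) : Prop :=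
  ∃ g : L2Field Ω, IsH10WithGradient Ω u g ∧
    ∀ φ : 𝓓(Ω, ℝ),
      ∫ x in (Ω : Set (EuclideanSpace ℝ (Fin d))), inner ℝ (g x) (gradient φ x) =
        - ∫ x in (Ω : Set (EuclideanSpace ℝ (Fin d))), f x * φ x

/-- `e` is an eigenfunction of `-Δ`, with homogeneous Dirichlet boundary condition, for the
eigenvalue `lam`. -/
def IsDirichletEigenfunction {d : ℕ} (Ω : TopologicalSpace.Opens (EuclideanSpace ℝ (Fin d)))
    (lam : ℝ) (e : L2 Ω) : Prop :=
  e ≠ 0 ∧ HasDirichletLaplacian Ω e (-(lam • e))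

/-- The graph of the operator `(aΔ, -bΔ; bΔ, aΔ)` on `L²(Ω; ℝ²)` with Dirichlet boundary condition:
the state `z` is in the domain and is mapped to `w`. -/
def HasCoupledLaplacian {d : ℕ} (Ω : TopologicalSpace.Opens (EuclideanSpace ℝ (Fin d)))
    (a b : ℝ) (z w : State Ω) : Prop :=
  ∃ f₁ f₂ : L2 Ω, HasDirichletLaplacian Ω z.fst f₁ ∧ HasDirichletLaplacian Ω z.snd f₂ ∧
    w = mkState (a • f₁ - b • f₂) (b • f₁ + a • f₂)

/-- Strongly continuous one-parameter semigroups of bounded operators on a normed space. -/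
structure IsC0Semigroup {X : Type*} [NormedAddCommGroup X] [NormedSpace ℝ X]
    (S : ℝ≥0 → X →L[ℝ] X) : Prop where
  map_zero : S 0 = ContinuousLinearMap.id ℝ X
  map_add : ∀ s t : ℝ≥0, S (s + t) = (S s).comp (S t)
  continuous_orbit : ∀ x : X, Continuous fun t : ℝ≥0 => S t x

/-- `S` is the strongly continuous semigroup `t ↦ e^{t𝒜}` generated by the (unbounded) operator
`𝒜` with graph `G`: the operator `x ↦ lim_{h → 0+} (S(h)x - x)/h`, defined exactly for the `x`
for which this limit exists, has graph `G`. -/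
structure IsSemigroupGeneratedBy {X : Type*} [NormedAddCommGroup X] [NormedSpace ℝ X]
    (G : X → X → Prop) (S : ℝ≥0 → X →L[ℝ] X) : Prop where
  isC0Semigroup : IsC0Semigroup S
  generator_iff : ∀ x y : X,
    G x y ↔ Tendsto (fun h : ℝ≥0 => (h : ℝ)⁻¹ • (S h x - x)) (𝓝[>] 0) (𝓝 y)

/-- The observation operator `B = (1, 0)`: the first component of a state. -/
def observe {d : ℕ} {Ω : TopologicalSpace.Opens (EuclideanSpace ℝ (Fin d))} (z : State Ω) : L2 Ω :=
  z.fst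

/-- The interpolation observability inequality at the times `τ i`, with observation sets `ω i`,
observations measured in the `L^p` norm, interpolation exponent `θ` and constant `C`:
`‖S(T)z‖ ≤ C (∑ i, ‖χ_{ω i} B S(τ i)z‖_{L^p})^(1-θ) ‖z‖^θ` for all states `z`. -/
def InterpolationObservability {d : ℕ} {Ω : TopologicalSpace.Opens (EuclideanSpace ℝ (Fin d))}
    (S : ℝ≥0 → State Ω →L[ℝ] State Ω) (T : ℝ≥0) {m : ℕ} (τ : Fin m → ℝ≥0)
    (ω : Fin m → Set (EuclideanSpace ℝ (Fin d))) (p : ℝ≥0∞) (θ C : ℝ) : Prop :=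
  ∀ z : State Ω, ‖S T z‖ ≤
    C * (∑ i, (eLpNorm (observe (S (τ i) z)) p (volume.restrict (ω i))).toReal) ^ (1 - θ)
      * ‖z‖ ^ θ

end StronglyCoupled

/-! On an eigenfunction of `-Δ` with eigenvalue `λ` the system reduces to the planar equation `z' =
-λ (a, -b; b, a) z`. Its flow damps by `exp (-aλt)` and rotates by the angle `bλt`. Suitable data
thus make the first component vanish at a prescribed time, and again after every full turn, that is
after each multiple of `2π / (bλ)`. When `λ` is large, `m` such times fit into `(0, T)`. The damped
rotation is injective, so the state at time `T` is nonzero while every observation vanishes: the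
right side of an interpolation inequality is then `0` and the left side is positive.

The work lies in the eigenvalues and the semigroup. Rellich's theorem (`isCompactOperator_embed`)
makes `(1 - Δ)⁻¹` compact, and `hasDirichletLaplacian_iff` expresses the Laplacian through it. The
spectral theorem and the infinite dimension of `L²(Ω)` then give an eigenbasis with unbounded
eigenvalues (`exists_dirichlet_eigenbasis`). In this basis the semigroup is built by diagonal
multipliers (`exists_isRotation`), and its generator is identified by comparing coordinates
(`tendsto_generator_iff_of_isRotation`, `hasCoupledLaplacian_iff`).

Any generated semigroup follows classical solutions (`semigroup_apply_eq_of_hasDerivAt`), so it acts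
on eigenmodes by the explicit formula `semigroup_eigenmode`. This yields both uniqueness and the
counterexample. -/

namespace StronglyCoupled

universe u

/-! ### Diagonal operators and orthonormal bases of eigenvectors -/

section Diagonal

variable {ι : Type*} {H : Type u} [NormedAddCommGroup H] [InnerProductSpace ℝ H]

theorem ext_of_inner (e : HilbertBasis ι ℝ H) {x y : H}
    (h : ∀ i, inner ℝ (e i) x = inner ℝ (e i) y) : x = y := by
  apply e.repr.injective
  ext i
  rw [e.repr_apply_apply, e.repr_apply_apply, h i]

theorem mem_of_basis_mem (e : HilbertBasis ι ℝ H) (W : Submodule ℝ H) (hW : IsClosed (W : Set H))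
    (h : ∀ i, e i ∈ W) (x : H) : x ∈ W := by
  have : (Submodule.span ℝ (Set.range e)).topologicalClosure ≤ W :=
    Submodule.topologicalClosure_minimal _
      (Submodule.span_le.2 (Set.range_subset_iff.2 h)) hW
  rw [e.dense_span] at this
  exact this trivial

/-- Multiplication by a sequence bounded by `1` is a contraction of `ℓ²`; it is conjugated with the
coordinate isometry `e.repr`. -/
theorem exists_diagonal (e : HilbertBasis ι ℝ H) (c : ι → ℝ) (hc : ∀ i, |c i| ≤ 1) :
    ∃ D : H →L[ℝ] H, (∀ x, ‖D x‖ ≤ ‖x‖) ∧ ∀ x i, inner ℝ (e i) (D x) = c i * inner ℝ (e i) x := by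
  have hle : ∀ (f : lp (fun _ : ι => ℝ) 2) i, ‖c i * f i‖ ≤ ‖f i‖ := fun f i => by
    rw [norm_mul]
    exact mul_le_of_le_one_left (norm_nonneg _) (hc i)
  have hmem : ∀ f : lp (fun _ : ι => ℝ) 2, Memℓp (fun i => c i * f i) 2 := fun f =>
    (lp.memℓp f).mono' (hle f)
  let M : lp (fun _ : ι => ℝ) 2 →ₗ[ℝ] lp (fun _ : ι => ℝ) 2 :=
    { toFun := fun f => ⟨fun i => c i * f i, hmem f⟩
      map_add' := fun f g => by ext i; exact mul_add _ _ _
      map_smul' := fun r f => by ext i; simp [mul_left_comm] }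
  have hM : ∀ f, ‖M f‖ ≤ 1 * ‖f‖ := fun f => by
    rw [one_mul]
    exact lp.norm_mono two_ne_zero (hle f)
  refine ⟨(e.repr.symm : lp (fun _ : ι => ℝ) 2 →L[ℝ] H) ∘L (M.mkContinuous 1 hM) ∘L
    (e.repr : H →L[ℝ] lp (fun _ : ι => ℝ) 2), fun x => ?_, fun x i => ?_⟩
  · simpa using hM (e.repr x)
  · rw [← e.repr_apply_apply, ← e.repr_apply_apply]
    simp [M]

/-- Contractions that are diagonal in an orthonormal basis, with multipliers that depend
continuously on a parameter, depend continuously on it in the strong topology. -/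
theorem continuous_diagonal {P : Type*} [TopologicalSpace P] (e : HilbertBasis ι ℝ H)
    {c : P → ι → ℝ} (hc : ∀ i, Continuous fun t => c t i) {D : P → H →L[ℝ] H}
    (hD : ∀ t x, ‖D t x‖ ≤ ‖x‖)
    (hDc : ∀ t x i, inner ℝ (e i) (D t x) = c t i * inner ℝ (e i) x) (x : H) :
    Continuous fun t => D t x := by
  let W : Submodule ℝ H :=
    { carrier := {x | Continuous fun t => D t x}
      add_mem' := fun {x y} hx hy => by
        simp only [Set.mem_ofPred_eq, map_add] at *
        exact Continuous.add hx hy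
      zero_mem' := by simpa using continuous_const
      smul_mem' := fun r x hx => by
        simp only [Set.mem_ofPred_eq, map_smul] at *
        exact Continuous.const_smul hx r }
  refine mem_of_basis_mem e W ?_ (fun i => ?_) x
  -- The contraction bound is uniform in `t`, so a limit of vectors with continuous orbits has an
  -- orbit that is a uniform limit of continuous ones.
  · refine isClosed_of_closure_subset fun y hy => ?_
    refine continuous_of_uniform_approx_of_continuous fun u hu => ?_
    obtain ⟨ε, hε, hεu⟩ := Metric.mem_uniformity_dist.1 hu
    obtain ⟨z, hz, hyz⟩ := Metric.mem_closure_iff.1 hy ε hε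
    refine ⟨fun t => D t z, hz, fun t => hεu ?_⟩
    rw [dist_eq_norm, ← map_sub]
    exact (hD _ _).trans_lt (by rwa [← dist_eq_norm])
  · have : (fun t => D t (e i)) = fun t => c t i • e i := by
      funext t
      refine ext_of_inner e fun j => ?_
      rw [hDc, inner_smul_right]
      by_cases hij : j = i
      · rw [hij]
      · rw [e.orthonormal.2 hij, mul_zero, mul_zero]
    change Continuous fun t => D t (e i)
    rw [this]
    exact (hc i).smul continuous_const

/-- The eigenvalues of a compact operator with an orthonormal basis of eigenvectors are not bounded
away from zero in infinite dimension. -/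
theorem exists_eigenvalue_lt {K : H →L[ℝ] H} (hK : IsCompactOperator K)
    (hinf : ¬ FiniteDimensional ℝ H) (e : HilbertBasis ι ℝ H) {μ : ι → ℝ}
    (hKe : ∀ x i, inner ℝ (e i) (K x) = μ i * inner ℝ (e i) x)
    {δ : ℝ} (hδ : 0 < δ) : ∃ i, μ i < δ := by
  by_contra! hμ
  -- If all `μ i ≥ δ`, the multipliers `δ / μ i` define a bounded operator inverting `K` up to the
  -- factor `δ`, so the identity would be compact.
  obtain ⟨D, -, hD⟩ := exists_diagonal e (fun i => δ / μ i) fun i => by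
    have : 0 < μ i := hδ.trans_le (hμ i)
    rw [abs_of_pos (by positivity)]
    exact (div_le_one this).2 (hμ i)
  have hid : ⇑(D ∘L K) = δ • (id : H → H) := by
    funext x
    refine ext_of_inner e fun i => ?_
    have : μ i ≠ 0 := (hδ.trans_le (hμ i)).ne'
    simp only [ContinuousLinearMap.comp_apply, hD, hKe, Pi.smul_apply, id, inner_smul_right]
    field_simp
  have hcomp : IsCompactOperator ⇑(D ∘L K) := hK.clm_comp D
  rw [hid, IsCompactOperator.smul_iff₀ hδ.ne'] at hcomp
  exact hinf (FiniteDimensional.of_isCompactOperator_id (𝕜 := ℝ) hcomp)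

variable [CompleteSpace H]

/-- A complete orthogonal family of closed subspaces has an adapted orthonormal basis. -/
theorem exists_hilbertBasis_of_orthogonalFamily {κ : Type} (V : κ → Submodule ℝ H)
    [∀ k, CompleteSpace (V k)]
    (hV : OrthogonalFamily ℝ (fun k => V k) fun k => (V k).subtypeₗᵢ) (hbot : (⨆ k, V k)ᗮ = ⊥) :
    ∃ (ι : Type u) (e : HilbertBasis ι ℝ H), ∀ i, ∃ k, e i ∈ V k := by
  choose w v hv using fun k => exists_hilbertBasis ℝ (V k)
  have hon := hV.orthonormal_sigma_orthonormal
    (v_family := fun k => (v k : w k → V k)) (fun k => (v k).orthonormal)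
  have hbot' : (Submodule.span ℝ
      (Set.range fun a : Σ k, w k => (V a.1).subtypeₗᵢ (v a.1 a.2)))ᗮ = ⊥ := by
    rw [eq_bot_iff, ← hbot]
    intro x hx
    rw [Submodule.mem_orthogonal'] at hx ⊢
    have hmem : ∀ k, ∀ y ∈ V k, inner ℝ x y = 0 := by
      intro k y hy
      exact mem_of_basis_mem (v k) ((innerSL ℝ x) ∘L (V k).subtypeL).ker
        (ContinuousLinearMap.isClosed_ker _)
        (fun i => hx _ (Submodule.subset_span ⟨⟨k, i⟩, rfl⟩)) ⟨y, hy⟩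
    intro y hy
    refine Submodule.iSup_induction (p := V) (motive := fun y => inner ℝ x y = 0) hy hmem
      (inner_zero_right _) fun y z hy hz => by rw [inner_add_right, hy, hz, add_zero]
  refine ⟨_, HilbertBasis.mkOfOrthogonalEqBot hon hbot', fun a => ⟨a.1, ?_⟩⟩
  rw [HilbertBasis.coe_mkOfOrthogonalEqBot]
  exact (v a.1 a.2).2

/-- A compact symmetric operator has an orthonormal basis of eigenvectors. -/
theorem exists_hilbertBasis_eigenvectors {K : H →L[ℝ] H} (hK : IsCompactOperator K)
    (hs : K.IsSymmetric) :
    ∃ (ι : Type u) (e : HilbertBasis ι ℝ H) (μ : ι → ℝ), ∀ i, K (e i) = μ i • e i := by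
  have hVc : ∀ μ : ℝ, CompleteSpace (Module.End.eigenspace (K : Module.End ℝ H) μ) := fun μ => by
    have h1 : (Module.End.eigenspace (K : Module.End ℝ H) μ : Set H) = {x | K x = μ • x} := by
      ext x
      exact Module.End.mem_eigenspace_iff
    have : IsClosed (Module.End.eigenspace (K : Module.End ℝ H) μ : Set H) := by
      rw [h1]
      exact isClosed_eq K.continuous (continuous_id.const_smul μ)
    exact this.completeSpace_coe
  obtain ⟨ι, e, he⟩ := exists_hilbertBasis_of_orthogonalFamily _ hs.orthogonalFamily_eigenspaces
    (ContinuousLinearMap.orthogonalComplement_iSup_eigenspaces_eq_bot hK hs)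
  choose μ hμ using he
  exact ⟨ι, e, μ, fun i => Module.End.mem_eigenspace_iff.1 (hμ i)⟩

end Diagonal

/-! ### Translation and ball-average estimates in `L²` -/

theorem lintegral_sq_le {α : Type*} [MeasurableSpace α] (μ : Measure α) {f : α → ℝ≥0∞}
    (hf : AEMeasurable f μ) : (∫⁻ x, f x ∂μ) ^ 2 ≤ μ Set.univ * ∫⁻ x, f x ^ 2 ∂μ := by
  have h := ENNReal.lintegral_mul_le_Lp_mul_Lq μ (Real.HolderConjugate.two_two) hf
    (aemeasurable_const (b := (1 : ℝ≥0∞)))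
  simp only [Pi.mul_apply, mul_one, lintegral_const, ENNReal.rpow_two, one_pow,
    one_mul] at h
  calc (∫⁻ x, f x ∂μ) ^ 2
      ≤ ((∫⁻ x, f x ^ 2 ∂μ) ^ ((1 : ℝ) / 2) * μ Set.univ ^ ((1 : ℝ) / 2)) ^ 2 := by gcongr
    _ = μ Set.univ * ∫⁻ x, f x ^ 2 ∂μ := by
      rw [mul_pow, ← ENNReal.rpow_natCast, ← ENNReal.rpow_natCast, ← ENNReal.rpow_mul,
        ← ENNReal.rpow_mul]
      norm_num [mul_comm]

/-- The fundamental theorem of calculus on the segment from `x` to `x + h`, followed by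
Cauchy–Schwarz on the unit interval. -/
theorem enorm_sub_sq_le_lintegral_fderiv {E : Type*} [NormedAddCommGroup E]
    [InnerProductSpace ℝ E] {φ : E → ℝ} (hφ : ContDiff ℝ 1 φ) (x h : E) :
    ‖φ (x + h) - φ x‖ₑ ^ 2 ≤
      ‖h‖ₑ ^ 2 * ∫⁻ t in Set.Ioc (0 : ℝ) 1, ‖fderiv ℝ φ (x + t • h)‖ₑ ^ 2 := by
  have hcont : Continuous fun t : ℝ => fderiv ℝ φ (x + t • h) :=
    (hφ.continuous_fderiv one_ne_zero).comp (by fun_prop)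
  have hd : ∀ t : ℝ, HasDerivAt (fun t : ℝ => φ (x + t • h)) (fderiv ℝ φ (x + t • h) h) t := by
    intro t
    have h1 : HasDerivAt (fun t : ℝ => x + t • h) h t := by
      simpa using ((hasDerivAt_id t).smul_const h).const_add x
    exact ((hφ.differentiable one_ne_zero _).hasFDerivAt).comp_hasDerivAt t h1
  have hI := intervalIntegral.integral_eq_sub_of_hasDerivAt (a := 0) (b := 1)
    (fun t _ => hd t) ((hcont.clm_apply continuous_const).intervalIntegrable 0 1)
  simp only [one_smul, zero_smul, add_zero] at hI
  rw [← hI, intervalIntegral.integral_of_le zero_le_one]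
  calc ‖∫ t in Set.Ioc (0 : ℝ) 1, fderiv ℝ φ (x + t • h) h‖ₑ ^ 2
      ≤ (∫⁻ t in Set.Ioc (0 : ℝ) 1, ‖fderiv ℝ φ (x + t • h)‖ₑ * ‖h‖ₑ) ^ 2 := by
        gcongr
        refine (enorm_integral_le_lintegral_enorm _).trans (lintegral_mono fun t => ?_)
        exact ContinuousLinearMap.le_opENorm _ _
    _ ≤ _ := by
        refine (lintegral_sq_le _ ?_).trans ?_
        · exact (hcont.enorm.measurable.mul_const _).aemeasurable
        · simp only [mul_pow]
          rw [lintegral_mul_const _ (hcont.enorm.measurable.pow_const 2)]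
          simp [mul_comm]

section Translation

variable {E : Type*} [NormedAddCommGroup E] [InnerProductSpace ℝ E] [FiniteDimensional ℝ E]
  [MeasurableSpace E] [BorelSpace E]

/-- Translating a `C¹` function by `h` moves it in `L²` by at most `‖h‖` times the `L²` norm of its
derivative. -/
theorem lintegral_translate_sub_sq_le {φ : E → ℝ} (hφ : ContDiff ℝ 1 φ) (h : E) :
    ∫⁻ x, ‖φ (x + h) - φ x‖ₑ ^ 2 ≤ ‖h‖ₑ ^ 2 * ∫⁻ x, ‖fderiv ℝ φ x‖ₑ ^ 2 := by
  have hcont : Continuous (fderiv ℝ φ) := hφ.continuous_fderiv one_ne_zero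
  calc ∫⁻ x, ‖φ (x + h) - φ x‖ₑ ^ 2
      ≤ ∫⁻ x, ‖h‖ₑ ^ 2 * ∫⁻ t in Set.Ioc (0 : ℝ) 1, ‖fderiv ℝ φ (x + t • h)‖ₑ ^ 2 :=
        lintegral_mono fun x => enorm_sub_sq_le_lintegral_fderiv hφ x h
    _ = ‖h‖ₑ ^ 2 * ∫⁻ x, ∫⁻ t in Set.Ioc (0 : ℝ) 1, ‖fderiv ℝ φ (x + t • h)‖ₑ ^ 2 :=
        lintegral_const_mul' _ _ (by simp)
    _ = ‖h‖ₑ ^ 2 * ∫⁻ t in Set.Ioc (0 : ℝ) 1, ∫⁻ x, ‖fderiv ℝ φ (x + t • h)‖ₑ ^ 2 := by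
        rw [lintegral_lintegral_swap]
        refine Continuous.aemeasurable ?_
        have : Continuous fun p : E × ℝ => fderiv ℝ φ (p.1 + p.2 • h) := hcont.comp (by fun_prop)
        exact (ENNReal.continuous_pow 2).comp this.enorm
    _ = _ := by
        congr 1
        have : ∀ t : ℝ, ∫⁻ x, ‖fderiv ℝ φ (x + t • h)‖ₑ ^ 2 = ∫⁻ x, ‖fderiv ℝ φ x‖ₑ ^ 2 :=
          fun t => lintegral_add_right_eq_self (fun x => ‖fderiv ℝ φ x‖ₑ ^ 2) (t • h)
        simp [this]

/-- The deviation of `φ x` from the mean of `φ` on a nearby ball. -/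
theorem enorm_sub_ball_mean_sq_le {φ : E → ℝ} (hφ : Continuous φ) {ε : ℝ} (hε : 0 < ε) {x c : E}
    (hxc : dist x c ≤ ε) :
    ‖φ x - (volume.real (Metric.ball c ε))⁻¹ * ∫ y in Metric.ball c ε, φ y‖ₑ ^ 2 ≤
      (volume (Metric.ball (0 : E) ε))⁻¹ *
        ∫⁻ h in Metric.ball (0 : E) (2 * ε), ‖φ (x + h) - φ x‖ₑ ^ 2 := by
  set V := volume (Metric.ball c ε) with hV
  have hVc : volume (Metric.ball (0 : E) ε) = V := (Measure.addHaar_ball_center _ _ _).symm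
  have hV0 : V ≠ 0 := (Metric.measure_ball_pos volume c hε).ne'
  have hVt : V ≠ ∞ := measure_ball_lt_top.ne
  have : Fact (volume (Metric.ball c ε) < ∞) := ⟨hVt.lt_top⟩
  have hVr : volume.real (Metric.ball c ε) ≠ 0 := by
    simp [Measure.real, ENNReal.toReal_eq_zero_iff, ← hV, hV0, hVt]
  have hint : IntegrableOn φ (Metric.ball c ε) :=
    (hφ.locallyIntegrable.integrableOn_isCompact (isCompact_closedBall c ε)).mono_set
      Metric.ball_subset_closedBall
  have heq : φ x - (volume.real (Metric.ball c ε))⁻¹ * ∫ y in Metric.ball c ε, φ y =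
      (volume.real (Metric.ball c ε))⁻¹ * ∫ y in Metric.ball c ε, (φ x - φ y) := by
    rw [integral_sub (integrable_const _) hint]
    simp only [setIntegral_const, smul_eq_mul]
    field_simp
  have hen : ‖(volume.real (Metric.ball c ε))⁻¹‖ₑ = V⁻¹ := by
    rw [Real.enorm_of_nonneg (by positivity), ENNReal.ofReal_inv_of_pos (by positivity),
      Measure.real, ENNReal.ofReal_toReal hVt]
  rw [heq, enorm_mul, hen, mul_pow, hVc]
  calc V⁻¹ ^ 2 * ‖∫ y in Metric.ball c ε, (φ x - φ y)‖ₑ ^ 2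
      ≤ V⁻¹ ^ 2 * (∫⁻ y in Metric.ball c ε, ‖φ x - φ y‖ₑ) ^ 2 := by
        gcongr; exact enorm_integral_le_lintegral_enorm _
    _ ≤ V⁻¹ ^ 2 * (V * ∫⁻ y in Metric.ball c ε, ‖φ x - φ y‖ₑ ^ 2) := by
        gcongr
        refine (lintegral_sq_le _ ?_).trans (by simp [hV])
        exact ((continuous_const.sub hφ).enorm).aemeasurable
    _ = V⁻¹ * ∫⁻ y in Metric.ball c ε, ‖φ x - φ y‖ₑ ^ 2 := by
        rw [← mul_assoc, pow_two, mul_assoc V⁻¹, ENNReal.inv_mul_cancel hV0 hVt, mul_one]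
    _ ≤ _ := by
        refine mul_le_mul_right ?_ _
        -- Substitute `y = x + h`. Since `x` is within `ε` of `c`, every `y` in the ball gives `‖h‖
        -- < 2ε`; the new domain no longer depends on `c`.
        rw [← lintegral_indicator Metric.isOpen_ball.measurableSet,
          ← lintegral_indicator Metric.isOpen_ball.measurableSet,
          ← lintegral_add_left_eq_self _ x]
        refine lintegral_mono fun h => ?_
        by_cases hh : x + h ∈ Metric.ball c ε
        · have : h ∈ Metric.ball (0 : E) (2 * ε) := by
            rw [mem_ball_zero_iff]
            rw [mem_ball_iff_norm] at hh
            rw [dist_eq_norm] at hxc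
            calc ‖h‖ = ‖(x + h - c) - (x - c)‖ := by congr 1; abel
              _ ≤ _ := norm_sub_le _ _
              _ < 2 * ε := by linarith
          rw [Set.indicator_of_mem hh, Set.indicator_of_mem this, enorm_sub_rev]
        · rw [Set.indicator_of_notMem hh]; exact zero_le

/-- The pointwise bound does not involve `s x`, so Tonelli applies with no regularity of `s`, and
each translation by `h` costs at most `(2ε)²` times the energy. The factor `2 ^ finrank` is the
volume ratio of the balls of radii `2ε` and `ε`. -/
theorem lintegral_sub_ball_mean_sq_le {φ : E → ℝ} (hφ : ContDiff ℝ 1 φ) {ε : ℝ} (hε : 0 < ε)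
    {s : E → E} {A : Set E} (hA : MeasurableSet A) (hs : ∀ x ∈ A, dist x (s x) ≤ ε) :
    ∫⁻ x in A, ‖φ x - (volume.real (Metric.ball (s x) ε))⁻¹ *
        ∫ y in Metric.ball (s x) ε, φ y‖ₑ ^ 2 ≤
      ENNReal.ofReal (2 ^ Module.finrank ℝ E * (2 * ε) ^ 2) * ∫⁻ x, ‖fderiv ℝ φ x‖ₑ ^ 2 := by
  set V := volume (Metric.ball (0 : E) ε) with hV
  have hV0 : V ≠ 0 := (Metric.measure_ball_pos volume 0 hε).ne'
  have hVt : V ≠ ∞ := measure_ball_lt_top.ne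
  have hV2 : volume (Metric.ball (0 : E) (2 * ε)) =
      ENNReal.ofReal (2 ^ Module.finrank ℝ E) * V := by
    rw [Measure.addHaar_ball_mul_of_pos _ _ two_pos]
  calc _ ≤ ∫⁻ x in A, V⁻¹ * ∫⁻ h in Metric.ball (0 : E) (2 * ε), ‖φ (x + h) - φ x‖ₑ ^ 2 :=
        setLIntegral_mono' hA fun x hx => enorm_sub_ball_mean_sq_le hφ.continuous hε (hs x hx)
    _ ≤ ∫⁻ x, V⁻¹ * ∫⁻ h in Metric.ball (0 : E) (2 * ε), ‖φ (x + h) - φ x‖ₑ ^ 2 :=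
        setLIntegral_le_lintegral _ _
    _ = V⁻¹ * ∫⁻ h in Metric.ball (0 : E) (2 * ε), ∫⁻ x, ‖φ (x + h) - φ x‖ₑ ^ 2 := by
        rw [lintegral_const_mul' _ _ (ENNReal.inv_ne_top.2 hV0), lintegral_lintegral_swap]
        refine Continuous.aemeasurable ?_
        have : Continuous fun p : E × E => φ (p.1 + p.2) - φ p.1 := by
          have := hφ.continuous
          fun_prop
        exact (ENNReal.continuous_pow 2).comp this.enorm
    _ ≤ V⁻¹ * ∫⁻ _ in Metric.ball (0 : E) (2 * ε),
          (ENNReal.ofReal ((2 * ε) ^ 2) * ∫⁻ x, ‖fderiv ℝ φ x‖ₑ ^ 2) := by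
        refine mul_le_mul_right (setLIntegral_mono' Metric.isOpen_ball.measurableSet
          fun h hh => (lintegral_translate_sub_sq_le hφ h).trans ?_) _
        gcongr
        rw [← ofReal_norm, ← ENNReal.ofReal_pow (norm_nonneg _)]
        rw [mem_ball_zero_iff] at hh
        gcongr
    _ = _ := by
        rw [setLIntegral_const, hV2, ENNReal.ofReal_mul (by positivity)]
        calc V⁻¹ * (ENNReal.ofReal ((2 * ε) ^ 2) * (∫⁻ x, ‖fderiv ℝ φ x‖ₑ ^ 2) *
              (ENNReal.ofReal (2 ^ Module.finrank ℝ E) * V))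
            = (V⁻¹ * V) * (ENNReal.ofReal (2 ^ Module.finrank ℝ E) *
              ENNReal.ofReal ((2 * ε) ^ 2) * ∫⁻ x, ‖fderiv ℝ φ x‖ₑ ^ 2) := by ring
          _ = _ := by rw [ENNReal.inv_mul_cancel hV0 hVt, one_mul]

/-- A bounded set is within `ε` of the range of a simple function that moves its points by at
most `ε`. -/
theorem exists_simpleFunc_dist_le {A : Set E} (hA : Bornology.IsBounded A) {ε : ℝ} (hε : 0 < ε) :
    ∃ s : SimpleFunc E E, ∀ x ∈ A, dist x (s x) ≤ ε := by
  obtain ⟨t, ht, hcov⟩ := Metric.totallyBounded_iff.1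
    (hA.isCompact_closure.totallyBounded.subset subset_closure) ε hε
  rcases t.eq_empty_or_nonempty with rfl | hne
  · have : A = ∅ := by simpa using hcov
    exact ⟨SimpleFunc.const E 0, by simp [this]⟩
  obtain ⟨e, rfl⟩ := ht.countable.exists_eq_range hne
  -- `SimpleFunc.nearestPt` looks only at `e 0, …, e N`, so `N` must be large enough to reach every
  -- point of the finite net.
  obtain ⟨N, hN⟩ : ∃ N : ℕ, ∀ y ∈ Set.range e, ∃ k ≤ N, e k = y := by
    choose! k hk using fun y (hy : y ∈ Set.range e) => hy
    obtain ⟨N, hN⟩ := (ht.image k).bddAbove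
    exact ⟨N, fun y hy => ⟨k y, hN ⟨y, hy, rfl⟩, hk y hy⟩⟩
  refine ⟨SimpleFunc.nearestPt e N, fun x hx => ?_⟩
  obtain ⟨y, hy, hxy⟩ := Set.mem_iUnion₂.1 (hcov hx)
  obtain ⟨k, hk, rfl⟩ := hN y hy
  have h1 := SimpleFunc.edist_nearestPt_le e x hk
  rw [edist_dist, edist_dist, ENNReal.ofReal_le_ofReal_iff dist_nonneg] at h1
  rw [dist_comm]
  refine h1.trans ?_
  rw [dist_comm]
  exact (Metric.mem_ball.1 hxy).le

end Translation

/-! ### The space `H¹₀(Ω)` and the resolvent of the Dirichlet Laplacian -/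

theorem inner_pair {E F : Type*} [NormedAddCommGroup E] [InnerProductSpace ℝ E]
    [NormedAddCommGroup F] [InnerProductSpace ℝ F] (x y : WithLp 2 (E × F)) :
    inner ℝ x y = inner ℝ x.fst y.fst + inner ℝ x.snd y.snd :=
  WithLp.prod_inner_apply x y

variable {d : ℕ} {Ω : TopologicalSpace.Opens (EuclideanSpace ℝ (Fin d))}

theorem continuous_gradient (φ : 𝓓(Ω, ℝ)) : Continuous (gradient φ) :=
  (InnerProductSpace.toDual ℝ (EuclideanSpace ℝ (Fin d))).symm.continuous.comp
    (φ.contDiff.continuous_fderiv (by simp))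

theorem norm_gradient (φ : EuclideanSpace ℝ (Fin d) → ℝ) (x : EuclideanSpace ℝ (Fin d)) :
    ‖gradient φ x‖ = ‖fderiv ℝ φ x‖ :=
  LinearIsometryEquiv.norm_map _ _

theorem hasCompactSupport_gradient (φ : 𝓓(Ω, ℝ)) : HasCompactSupport (gradient φ) :=
  (φ.hasCompactSupport.fderiv (𝕜 := ℝ)).comp_left (map_zero _)

theorem memLp_test (φ : 𝓓(Ω, ℝ)) :
    MemLp φ 2 (volume.restrict (Ω : Set (EuclideanSpace ℝ (Fin d)))) :=
  (φ.continuous.memLp_of_hasCompactSupport φ.hasCompactSupport).restrict _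

theorem memLp_gradient (φ : 𝓓(Ω, ℝ)) :
    MemLp (gradient φ) 2 (volume.restrict (Ω : Set (EuclideanSpace ℝ (Fin d)))) :=
  ((continuous_gradient φ).memLp_of_hasCompactSupport (hasCompactSupport_gradient φ)).restrict _

/-- The class in `L²(Ω)` of a test function. -/
noncomputable def testL2 (φ : 𝓓(Ω, ℝ)) : L2 Ω := (memLp_test φ).toLp _

/-- The class in `L²(Ω)` of the gradient of a test function. -/
noncomputable def testGradient (φ : 𝓓(Ω, ℝ)) : L2Field Ω := (memLp_gradient φ).toLp _

theorem mem_testGraph_iff {q : L2 Ω × L2Field Ω} :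
    q ∈ testGraph Ω ↔ ∃ φ : 𝓓(Ω, ℝ), q = (testL2 φ, testGradient φ) := by
  refine exists_congr fun φ => ⟨fun ⟨h1, h2⟩ => ?_, ?_⟩
  · exact Prod.ext (Lp.ext (h1.trans (memLp_test φ).coeFn_toLp.symm))
      (Lp.ext (h2.trans (memLp_gradient φ).coeFn_toLp.symm))
  · rintro rfl
    exact ⟨(memLp_test φ).coeFn_toLp, (memLp_gradient φ).coeFn_toLp⟩

theorem gradient_add_test (φ ψ : 𝓓(Ω, ℝ)) :
    gradient (⇑(φ + ψ)) = gradient φ + gradient ψ := by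
  funext x
  have h1 := φ.contDiff.differentiable (by simp) x
  have h2 := ψ.contDiff.differentiable (by simp) x
  simp only [gradient, Pi.add_apply, FunLike.coe_add]
  rw [fderiv_add h1 h2, map_add]

theorem gradient_smul_test (r : ℝ) (φ : 𝓓(Ω, ℝ)) :
    gradient (⇑(r • φ)) = r • gradient φ := by
  funext x
  have h1 := φ.contDiff.differentiable (by simp) x
  simp only [gradient, Pi.smul_apply, FunLike.coe_smul]
  rw [fderiv_const_smul h1]
  simp

/-- The test functions, embedded in `L²(Ω) × L²(Ω; ℝ^d)` by `φ ↦ (φ, ∇φ)`. -/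
noncomputable def testSubmodule (Ω : TopologicalSpace.Opens (EuclideanSpace ℝ (Fin d))) :
    Submodule ℝ (WithLp 2 (L2 Ω × L2Field Ω)) where
  carrier := {q | WithLp.ofLp q ∈ testGraph Ω}
  add_mem' := by
    rintro p q ⟨φ, h1, h2⟩ ⟨ψ, h3, h4⟩
    refine ⟨φ + ψ, ?_, ?_⟩
    · filter_upwards [Lp.coeFn_add p.fst q.fst, h1, h3] with x hx hx1 hx3
      exact hx.trans (congrArg₂ _ hx1 hx3)
    · rw [gradient_add_test]
      filter_upwards [Lp.coeFn_add p.snd q.snd, h2, h4] with x hx hx1 hx3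
      exact hx.trans (congrArg₂ (· + ·) hx1 hx3)
  zero_mem' := by
    refine ⟨0, ?_, ?_⟩
    · filter_upwards [Lp.coeFn_zero ℝ 2
        (volume.restrict (Ω : Set (EuclideanSpace ℝ (Fin d))))] with x hx
      exact hx
    · have : gradient (⇑(0 : 𝓓(Ω, ℝ))) = 0 := by
        simpa using gradient_smul_test (0 : ℝ) (0 : 𝓓(Ω, ℝ))
      rw [this]
      filter_upwards [Lp.coeFn_zero (EuclideanSpace ℝ (Fin d)) 2
        (volume.restrict (Ω : Set (EuclideanSpace ℝ (Fin d))))] with x hx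
      exact hx
  smul_mem' := by
    rintro r p ⟨φ, h1, h2⟩
    refine ⟨r • φ, ?_, ?_⟩
    · filter_upwards [Lp.coeFn_smul r p.fst, h1] with x hx hx1
      exact hx.trans (congrArg _ hx1)
    · rw [gradient_smul_test]
      filter_upwards [Lp.coeFn_smul r p.snd, h2] with x hx hx1
      exact hx.trans (congrArg (r • ·) hx1)

/-- The Hilbert space `H¹₀(Ω)`, as the space of pairs `(u, ∇u)`. -/
noncomputable abbrev H10 (Ω : TopologicalSpace.Opens (EuclideanSpace ℝ (Fin d))) :
    Submodule ℝ (WithLp 2 (L2 Ω × L2Field Ω)) :=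
  (testSubmodule Ω).topologicalClosure

theorem mem_H10_iff {q : WithLp 2 (L2 Ω × L2Field Ω)} :
    q ∈ H10 Ω ↔ IsH10WithGradient Ω q.fst q.snd := by
  have h := (WithLp.homeomorphProd 2 (L2 Ω) (L2Field Ω)).preimage_closure (testGraph Ω)
  rw [← SetLike.mem_coe, Submodule.topologicalClosure_coe]
  exact (Set.ext_iff.1 h q).symm

theorem mem_testSubmodule (φ : 𝓓(Ω, ℝ)) :
    WithLp.toLp 2 (testL2 φ, testGradient φ) ∈ testSubmodule Ω :=
  mem_testGraph_iff.2 ⟨φ, rfl⟩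

/-- Both sides say that `(f, g)` is orthogonal in the product space, to the test pairs or to their
closure, and a subspace and its closure have the same orthogonal complement. -/
theorem weak_equation_iff (f : L2 Ω) (g : L2Field Ω) :
    (∀ φ : 𝓓(Ω, ℝ),
      ∫ x in (Ω : Set (EuclideanSpace ℝ (Fin d))), inner ℝ (g x) (gradient φ x) =
        - ∫ x in (Ω : Set (EuclideanSpace ℝ (Fin d))), f x * φ x) ↔
    ∀ v ∈ H10 Ω, inner ℝ g v.snd = - inner ℝ f v.fst := by
  have h1 : ∀ φ : 𝓓(Ω, ℝ), inner ℝ g (testGradient φ) =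
      ∫ x in (Ω : Set (EuclideanSpace ℝ (Fin d))), inner ℝ (g x) (gradient φ x) := fun φ => by
    rw [L2.inner_def]
    refine integral_congr_ae ?_
    filter_upwards [(memLp_gradient φ).coeFn_toLp] with x hx
    rw [testGradient, hx]
  have h2 : ∀ φ : 𝓓(Ω, ℝ), inner ℝ f (testL2 φ) =
      ∫ x in (Ω : Set (EuclideanSpace ℝ (Fin d))), f x * φ x := fun φ => by
    rw [L2.inner_def]
    refine integral_congr_ae ?_
    filter_upwards [(memLp_test φ).coeFn_toLp] with x hx
    rw [testL2, hx]
    simp [mul_comm]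
  simp only [← h1, ← h2]
  have h3 : (∀ v ∈ H10 Ω, inner ℝ g v.snd = - inner ℝ f v.fst) ↔
      WithLp.toLp 2 (f, g) ∈ (H10 Ω)ᗮ := by
    rw [Submodule.mem_orthogonal']
    refine forall₂_congr fun v _ => ?_
    rw [inner_pair]
    change _ ↔ inner ℝ f v.fst + inner ℝ g v.snd = 0
    exact ⟨fun h => by linarith, fun h => by linarith⟩
  rw [h3, Submodule.orthogonal_closure, Submodule.mem_orthogonal']
  constructor
  · intro h v hv
    obtain ⟨φ, hφ⟩ := mem_testGraph_iff.1 hv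
    have h4 : v = WithLp.toLp 2 (testL2 φ, testGradient φ) := congrArg (WithLp.toLp 2) hφ
    have := h φ
    rw [h4, inner_pair]
    change inner ℝ f (testL2 φ) + inner ℝ g (testGradient φ) = 0
    linarith
  · intro h φ
    have := h _ (mem_testSubmodule φ)
    rw [inner_pair] at this
    change inner ℝ f (testL2 φ) + inner ℝ g (testGradient φ) = 0 at this
    linarith

/-- The embedding of `H¹₀(Ω)` into `L²(Ω)`. -/
noncomputable def embed (Ω : TopologicalSpace.Opens (EuclideanSpace ℝ (Fin d))) :
    H10 Ω →L[ℝ] L2 Ω :=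
  WithLp.fstL 2 ℝ (L2 Ω) (L2Field Ω) ∘L (H10 Ω).subtypeL

theorem embed_apply (v : H10 Ω) : embed Ω v = (v : WithLp 2 (L2 Ω × L2Field Ω)).fst := rfl

theorem norm_embed_le (v : H10 Ω) : ‖embed Ω v‖ ≤ ‖v‖ := by
  have := WithLp.prod_norm_sq_eq_of_L2 (v : WithLp 2 (L2 Ω × L2Field Ω))
  refine (sq_le_sq₀ (norm_nonneg _) (norm_nonneg _)).1 ?_
  change _ ≤ ‖(v : WithLp 2 (L2 Ω × L2Field Ω))‖ ^ 2
  rw [embed_apply, this]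
  exact le_add_of_nonneg_right (sq_nonneg _)

/-- The resolvent `(1 - Δ)⁻¹` of the Dirichlet Laplacian. -/
noncomputable def resolvent (Ω : TopologicalSpace.Opens (EuclideanSpace ℝ (Fin d))) :
    L2 Ω →L[ℝ] L2 Ω :=
  embed Ω ∘L (embed Ω).adjoint

/-- Adding `⟪u, v⟫` to the weak equation shows that `(u, g)` is the Riesz representative in `H¹₀` of
`v ↦ ⟪u - f, v⟫`, that is the adjoint of `embed` at `u - f`. The unbounded operator is thereby
traded for a bounded symmetric one. -/
theorem hasDirichletLaplacian_iff {u f : L2 Ω} :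
    HasDirichletLaplacian Ω u f ↔ u = resolvent Ω (u - f) := by
  constructor
  · rintro ⟨g, hg, hw⟩
    rw [weak_equation_iff] at hw
    have hmem : WithLp.toLp 2 (u, g) ∈ H10 Ω := mem_H10_iff.2 hg
    have : (⟨_, hmem⟩ : H10 Ω) = (embed Ω).adjoint (u - f) := by
      refine ext_inner_right ℝ fun v => ?_
      rw [ContinuousLinearMap.adjoint_inner_left, Submodule.coe_inner, inner_pair,
        embed_apply, inner_sub_left]
      have := hw v v.2
      change inner ℝ u (v : WithLp 2 (L2 Ω × L2Field Ω)).fst +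
        inner ℝ g (v : WithLp 2 (L2 Ω × L2Field Ω)).snd = _
      linarith
    rw [resolvent, ContinuousLinearMap.comp_apply, ← this]
    rfl
  · intro h
    set q := (embed Ω).adjoint (u - f) with hq
    have hu : u = (q : WithLp 2 (L2 Ω × L2Field Ω)).fst := h
    refine ⟨(q : WithLp 2 (L2 Ω × L2Field Ω)).snd, ?_, ?_⟩
    · rw [hu]
      exact mem_H10_iff.1 q.2
    · rw [weak_equation_iff]
      intro v hv
      have := (embed Ω).adjoint_inner_left ⟨v, hv⟩ (u - f)
      rw [← hq, Submodule.coe_inner, inner_pair, embed_apply, inner_sub_left] at this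
      have h4 : inner ℝ (q : WithLp 2 (L2 Ω × L2Field Ω)).fst v.fst = inner ℝ u v.fst := by
        rw [← hu]
      change _ = inner ℝ u v.fst - inner ℝ f v.fst at this
      linarith

theorem isSymmetric_resolvent : (resolvent Ω).IsSymmetric := fun x y => by
  change inner ℝ (embed Ω ((embed Ω).adjoint x)) y = inner ℝ x (embed Ω ((embed Ω).adjoint y))
  rw [← (embed Ω).adjoint_inner_right, ← (embed Ω).adjoint_inner_left]

theorem inner_resolvent_self (h : L2 Ω) :
    inner ℝ (resolvent Ω h) h = ‖(embed Ω).adjoint h‖ ^ 2 := by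
  rw [← real_inner_self_eq_norm_sq]
  exact ((embed Ω).adjoint_inner_right _ _).symm

theorem norm_resolvent_le (h : L2 Ω) : ‖resolvent Ω h‖ ≤ ‖h‖ := by
  have h1 : ‖embed Ω‖ ≤ 1 :=
    ContinuousLinearMap.opNorm_le_bound _ zero_le_one fun v => by simpa using norm_embed_le v
  have h2 : ‖(embed Ω).adjoint‖ ≤ 1 := by
    rwa [LinearIsometryEquiv.norm_map]
  calc ‖resolvent Ω h‖ ≤ ‖(embed Ω).adjoint h‖ := norm_embed_le _
    _ ≤ 1 * ‖h‖ := ContinuousLinearMap.le_of_opNorm_le _ h2 h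
    _ = ‖h‖ := one_mul _

/-- Square integrable functions are locally integrable, so the fundamental lemma of the calculus of
variations applies. -/
theorem eq_zero_of_inner_test_eq_zero {h : L2 Ω} (hh : ∀ φ : 𝓓(Ω, ℝ), inner ℝ h (testL2 φ) = 0) :
    h = 0 := by
  have hloc : LocallyIntegrableOn h (Ω : Set (EuclideanSpace ℝ (Fin d))) volume := by
    refine (locallyIntegrableOn_iff Ω.isOpen.isLocallyClosed).2 fun k hk hkc => ?_
    have h1 : MemLp h 2 (volume.restrict k) :=
      (Lp.memLp h).mono_measure (Measure.restrict_mono hk le_rfl)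
    have : IsFiniteMeasure (volume.restrict k) := ⟨by simpa using hkc.measure_lt_top⟩
    exact h1.integrable one_le_two
  have := Ω.isOpen.ae_eq_zero_of_integral_contDiff_smul_eq_zero hloc fun φ h1 h2 h3 => by
    have h4 := hh ⟨φ, by simpa using h1, h2, h3⟩
    rw [L2.inner_def] at h4
    rw [← setIntegral_eq_integral_of_forall_compl_eq_zero
      (s := (Ω : Set (EuclideanSpace ℝ (Fin d)))), ← h4]
    · refine integral_congr_ae ?_
      filter_upwards [(memLp_test (⟨φ, by simpa using h1, h2, h3⟩ : 𝓓(Ω, ℝ))).coeFn_toLp] with x hx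
      rw [testL2, hx]
      rfl
    · intro x hx
      rw [image_eq_zero_of_notMem_tsupport (fun hx' => hx (h3 hx')), zero_smul]
  refine Lp.ext ?_
  filter_upwards [(ae_restrict_iff' Ω.isOpen.measurableSet).2 this, Lp.coeFn_zero ℝ 2
    (volume.restrict (Ω : Set (EuclideanSpace ℝ (Fin d))))] with x hx hx0
  rw [hx, hx0]
  rfl

/-- The quadratic form of the resolvent is the squared norm of the adjoint of `embed`; if that
vanishes, `h` is orthogonal to all of `H¹₀`, in particular to the test functions. -/
theorem eq_zero_of_resolvent_eq_zero {h : L2 Ω} (hh : resolvent Ω h = 0) : h = 0 := by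
  have h1 : (embed Ω).adjoint h = 0 := by
    have := inner_resolvent_self h
    rw [hh, inner_zero_left] at this
    simpa using this.symm
  refine eq_zero_of_inner_test_eq_zero fun φ => ?_
  have := (embed Ω).adjoint_inner_left
    ⟨_, (testSubmodule Ω).le_topologicalClosure (mem_testSubmodule φ)⟩ h
  rw [h1, inner_zero_left] at this
  exact this.symm

/-! ### Rellich's theorem by finite rank averaging -/

theorem isCompactOperator_of_approx {X Y : Type*} [NormedAddCommGroup X] [NormedSpace ℝ X]
    [NormedAddCommGroup Y] [NormedSpace ℝ Y] [CompleteSpace Y] {f : X →L[ℝ] Y}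
    {F : ℕ → X →L[ℝ] Y} (hF : ∀ n, IsCompactOperator (F n)) {c : ℕ → ℝ}
    (hc : Tendsto c atTop (𝓝 0)) (h : ∀ n, ‖f - F n‖ ≤ c n) : IsCompactOperator f := by
  refine isCompactOperator_of_tendsto (F := F) (l := atTop) ?_ (Eventually.of_forall hF)
  refine tendsto_iff_norm_sub_tendsto_zero.2 (squeeze_zero (fun _ => norm_nonneg _) (fun n => ?_) hc)
  rw [norm_sub_rev]
  exact h n

/-- The finite rank operator that replaces `u` on each cell `s ⁻¹' {c}` by its mean over the ball
of radius `ε` around `c`. -/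
noncomputable def cellMean (Ω : TopologicalSpace.Opens (EuclideanSpace ℝ (Fin d))) (ε : ℝ)
    (s : SimpleFunc (EuclideanSpace ℝ (Fin d)) (EuclideanSpace ℝ (Fin d)))
    [IsFiniteMeasure (volume.restrict (Ω : Set (EuclideanSpace ℝ (Fin d))))] : L2 Ω →L[ℝ] L2 Ω :=
  ∑ c ∈ s.range, ContinuousLinearMap.smulRight
    ((volume.real (Metric.ball c ε))⁻¹ • innerSL ℝ (indicatorConstLp 2
      (μ := volume.restrict (Ω : Set (EuclideanSpace ℝ (Fin d))))
      (Metric.isOpen_ball (x := c) (ε := ε)).measurableSet (measure_ne_top _ _) (1 : ℝ)))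
    (indicatorConstLp 2 (μ := volume.restrict (Ω : Set (EuclideanSpace ℝ (Fin d))))
      (s.measurableSet_fiber c) (measure_ne_top _ _) (1 : ℝ))

theorem isCompactOperator_cellMean (ε : ℝ)
    (s : SimpleFunc (EuclideanSpace ℝ (Fin d)) (EuclideanSpace ℝ (Fin d)))
    [IsFiniteMeasure (volume.restrict (Ω : Set (EuclideanSpace ℝ (Fin d))))] :
    IsCompactOperator (cellMean Ω ε s) := by
  have hrank : ∀ (ℓ : L2 Ω →L[ℝ] ℝ) (x : L2 Ω), IsCompactOperator (ℓ.smulRight x) := by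
    intro ℓ x
    have h1 : IsCompactOperator ℓ :=
      (isCompactOperator_of_locallyCompactSpace_dom (ContinuousLinearMap.id ℝ ℝ)).comp_clm ℓ
    exact h1.clm_comp (ContinuousLinearMap.toSpanSingleton ℝ x)
  have : cellMean Ω ε s ∈ compactOperator (RingHom.id ℝ) (L2 Ω) (L2 Ω) :=
    Submodule.sum_mem _ fun c _ => hrank _ _
  exact this

/-- The functionals in `cellMean` integrate over the ball intersected with `Ω`. A test function
vanishes outside `Ω`, so this is the integral over the full ball, as the averaging estimate on the
whole space requires. -/
theorem cellMean_ae_eq (ε : ℝ)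
    (s : SimpleFunc (EuclideanSpace ℝ (Fin d)) (EuclideanSpace ℝ (Fin d)))
    [IsFiniteMeasure (volume.restrict (Ω : Set (EuclideanSpace ℝ (Fin d))))] (φ : 𝓓(Ω, ℝ)) :
    cellMean Ω ε s (testL2 φ) =ᵐ[volume.restrict (Ω : Set (EuclideanSpace ℝ (Fin d)))]
      fun x => (volume.real (Metric.ball (s x) ε))⁻¹ * ∫ y in Metric.ball (s x) ε, φ y := by
  have hℓ : ∀ c, inner ℝ (indicatorConstLp 2
      (μ := volume.restrict (Ω : Set (EuclideanSpace ℝ (Fin d))))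
      (Metric.isOpen_ball (x := c) (ε := ε)).measurableSet (measure_ne_top _ _) (1 : ℝ))
      (testL2 φ) = ∫ y in Metric.ball c ε, φ y := by
    intro c
    rw [L2.inner_indicatorConstLp_one, Measure.restrict_restrict Metric.isOpen_ball.measurableSet]
    have h1 : ∀ᵐ x ∂volume.restrict (Metric.ball c ε ∩ Ω), testL2 φ x = φ x :=
      ae_restrict_of_ae_restrict_of_subset Set.inter_subset_right (memLp_test φ).coeFn_toLp
    rw [integral_congr_ae h1]
    refine (setIntegral_eq_of_subset_of_forall_sdiff_eq_zero Metric.isOpen_ball.measurableSet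
      Set.inter_subset_left fun x hx => ?_).symm
    exact image_eq_zero_of_notMem_tsupport fun hx' => hx.2 ⟨hx.1, φ.tsupport_subset hx'⟩
  have hexp : cellMean Ω ε s (testL2 φ) = ∑ c ∈ s.range,
      ((volume.real (Metric.ball c ε))⁻¹ * ∫ y in Metric.ball c ε, φ y) •
        indicatorConstLp 2 (μ := volume.restrict (Ω : Set (EuclideanSpace ℝ (Fin d))))
          (s.measurableSet_fiber c) (measure_ne_top _ _) (1 : ℝ) := by
    simp only [cellMean, _root_.sum_apply, ContinuousLinearMap.smulRight_apply,
      _root_.smul_apply, innerSL_apply_apply, hℓ, smul_eq_mul]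
  rw [hexp]
  refine (Lp.coeFn_finsetSum _ _).trans ?_
  have hall : ∀ᵐ x ∂volume.restrict (Ω : Set (EuclideanSpace ℝ (Fin d))), ∀ c ∈ s.range,
      (((volume.real (Metric.ball c ε))⁻¹ * ∫ y in Metric.ball c ε, φ y) •
        indicatorConstLp 2 (μ := volume.restrict (Ω : Set (EuclideanSpace ℝ (Fin d))))
          (s.measurableSet_fiber c) (measure_ne_top _ _) (1 : ℝ) : L2 Ω) x =
      ((volume.real (Metric.ball c ε))⁻¹ * ∫ y in Metric.ball c ε, φ y) *
        (s ⁻¹' {c}).indicator (fun _ => (1 : ℝ)) x := by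
    refine (eventually_all_finset s.range).2 ?_
    intro c _
    filter_upwards [Lp.coeFn_smul ((volume.real (Metric.ball c ε))⁻¹ * ∫ y in Metric.ball c ε, φ y)
      (indicatorConstLp 2 (μ := volume.restrict (Ω : Set (EuclideanSpace ℝ (Fin d))))
          (s.measurableSet_fiber c) (measure_ne_top _ _) (1 : ℝ)),
      indicatorConstLp_coeFn (p := 2) (μ := volume.restrict (Ω : Set (EuclideanSpace ℝ (Fin d))))
        (hs := s.measurableSet_fiber c) (hμs := measure_ne_top _ _) (c := (1 : ℝ))] with x h1 h2
    rw [h1, Pi.smul_apply, h2, smul_eq_mul]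
  filter_upwards [hall] with x hx
  rw [Finset.sum_apply, Finset.sum_congr rfl hx, Finset.sum_eq_single (s x)]
  · simp
  · intro c _ hc
    rw [Set.indicator_of_notMem (by simpa using hc.symm), mul_zero]
  · intro h
    exact absurd (s.mem_range_self x) h

theorem norm_sub_cellMean_le {ε : ℝ} (hε : 0 < ε)
    {s : SimpleFunc (EuclideanSpace ℝ (Fin d)) (EuclideanSpace ℝ (Fin d))}
    (hs : ∀ x ∈ Ω, dist x (s x) ≤ ε)
    [IsFiniteMeasure (volume.restrict (Ω : Set (EuclideanSpace ℝ (Fin d))))] (φ : 𝓓(Ω, ℝ)) :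
    ‖testL2 φ - cellMean Ω ε s (testL2 φ)‖ ^ 2 ≤ 2 ^ d * (2 * ε) ^ 2 * ‖testGradient φ‖ ^ 2 := by
  have hnorm : ∀ {F : Type} [NormedAddCommGroup F]
      (f : Lp F 2 (volume.restrict (Ω : Set (EuclideanSpace ℝ (Fin d))))),
      ENNReal.ofReal (‖f‖ ^ 2) = ∫⁻ x in Ω, ‖f x‖ₑ ^ 2 := by
    intro F _ f
    rw [ENNReal.ofReal_pow (norm_nonneg _), Lp.norm_def, ENNReal.ofReal_toReal (Lp.eLpNorm_ne_top f),
      eLpNorm_eq_lintegral_rpow_enorm_toReal two_ne_zero ENNReal.ofNat_ne_top, ← ENNReal.rpow_natCast,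
      ← ENNReal.rpow_mul]
    norm_num
  rw [← ENNReal.ofReal_le_ofReal_iff (by positivity), ENNReal.ofReal_mul (by positivity), hnorm,
    hnorm]
  have h1 := lintegral_sub_ball_mean_sq_le (φ := φ) (φ.contDiff.of_le (by simp)) hε
    Ω.isOpen.measurableSet hs
  rw [finrank_euclideanSpace_fin] at h1
  refine (le_of_eq ?_).trans (h1.trans (le_of_eq ?_))
  · refine lintegral_congr_ae ?_
    filter_upwards [Lp.coeFn_sub (testL2 φ) (cellMean Ω ε s (testL2 φ)),
      (memLp_test φ).coeFn_toLp, cellMean_ae_eq ε s φ] with x h2 h3 h4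
    rw [h2, Pi.sub_apply, h4, testL2, h3]
  · congr 1
    rw [← setLIntegral_eq_of_support_subset (s := (Ω : Set (EuclideanSpace ℝ (Fin d))))]
    · refine lintegral_congr_ae ?_
      filter_upwards [(memLp_gradient φ).coeFn_toLp] with x hx
      rw [testGradient, hx, ← ofReal_norm, ← ofReal_norm, norm_gradient]
    · intro x hx
      by_contra hx'
      refine hx ?_
      have : fderiv ℝ φ x = 0 := image_eq_zero_of_notMem_tsupport fun h =>
        hx' (φ.tsupport_subset (tsupport_fderiv_subset ℝ h))
      change ‖fderiv ℝ φ x‖ₑ ^ 2 = 0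
      rw [this, ← ofReal_norm, norm_zero]
      simp

theorem norm_embed_sub_cellMean_le {ε : ℝ} (hε : 0 < ε)
    {s : SimpleFunc (EuclideanSpace ℝ (Fin d)) (EuclideanSpace ℝ (Fin d))}
    (hs : ∀ x ∈ Ω, dist x (s x) ≤ ε)
    [IsFiniteMeasure (volume.restrict (Ω : Set (EuclideanSpace ℝ (Fin d))))] :
    ‖embed Ω - cellMean Ω ε s ∘L embed Ω‖ ≤ Real.sqrt (2 ^ d) * (2 * ε) := by
  refine ContinuousLinearMap.opNorm_le_bound _ (by positivity) fun v => ?_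
  let A : WithLp 2 (L2 Ω × L2Field Ω) →L[ℝ] L2 Ω :=
    (ContinuousLinearMap.id ℝ _ - cellMean Ω ε s) ∘L WithLp.fstL 2 ℝ (L2 Ω) (L2Field Ω)
  have hclosed : IsClosed {q : WithLp 2 (L2 Ω × L2Field Ω) |
      ‖A q‖ ≤ Real.sqrt (2 ^ d) * (2 * ε) * ‖q‖} :=
    isClosed_le A.continuous.norm (continuous_const.mul continuous_norm)
  -- The inequality defines a closed set, so it passes from test functions to all of `H¹₀`.
  refine closure_minimal (s := (testSubmodule Ω : Set _)) (fun q hq => ?_) hclosed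
    ((testSubmodule Ω).topologicalClosure_coe ▸ v.2)
  obtain ⟨φ, hφ⟩ := mem_testGraph_iff.1 hq
  have hq' : q = WithLp.toLp 2 (testL2 φ, testGradient φ) := congrArg (WithLp.toLp 2) hφ
  have h1 := norm_sub_cellMean_le hε hs φ
  have h2 : ‖testGradient φ‖ ^ 2 ≤ ‖q‖ ^ 2 := by
    rw [WithLp.prod_norm_sq_eq_of_L2, hq']
    exact le_add_of_nonneg_left (sq_nonneg _)
  have h3 : A q = testL2 φ - cellMean Ω ε s (testL2 φ) := by rw [hq']; rfl
  change ‖A q‖ ≤ _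
  rw [h3]
  refine (sq_le_sq₀ (norm_nonneg _) (by positivity)).1 (h1.trans ?_)
  rw [mul_pow _ ‖q‖, mul_pow (Real.sqrt _), Real.sq_sqrt (by positivity)]
  gcongr

/-- Rellich's theorem: `H¹₀(Ω)` embeds compactly into `L²(Ω)` if `Ω` is bounded. -/
theorem isCompactOperator_embed (hΩ : Bornology.IsBounded (Ω : Set (EuclideanSpace ℝ (Fin d)))) :
    IsCompactOperator (embed Ω) := by
  have : IsFiniteMeasure (volume.restrict (Ω : Set (EuclideanSpace ℝ (Fin d)))) :=
    ⟨by simpa using hΩ.measure_lt_top⟩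
  choose s hs using fun n : ℕ =>
    exists_simpleFunc_dist_le hΩ (Nat.one_div_pos_of_nat (α := ℝ) (n := n))
  refine isCompactOperator_of_approx
    (F := fun n : ℕ => cellMean Ω (1 / ((n : ℝ) + 1)) (s n) ∘L embed Ω)
    (c := fun n : ℕ => Real.sqrt (2 ^ d) * (2 * (1 / ((n : ℝ) + 1))))
    (fun n => (isCompactOperator_cellMean _ _).comp_clm _) ?_
    (fun n => norm_embed_sub_cellMean_le Nat.one_div_pos_of_nat (hs n))
  simpa using ((tendsto_one_div_add_atTop_nhds_zero_nat (𝕜 := ℝ)).const_mul 2).const_mul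
    (Real.sqrt (2 ^ d))

theorem isCompactOperator_resolvent
    (hΩ : Bornology.IsBounded (Ω : Set (EuclideanSpace ℝ (Fin d)))) :
    IsCompactOperator (resolvent Ω) :=
  (isCompactOperator_embed hΩ).comp_clm _

/-! ### Unbounded eigenvalues of the Dirichlet Laplacian -/

theorem not_finiteDimensional_L2 (hd : 1 ≤ d)
    (hne : (Ω : Set (EuclideanSpace ℝ (Fin d))).Nonempty)
    (hΩ : Bornology.IsBounded (Ω : Set (EuclideanSpace ℝ (Fin d)))) :
    ¬ FiniteDimensional ℝ (L2 Ω) := by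
  have hfin : IsFiniteMeasure (volume.restrict (Ω : Set (EuclideanSpace ℝ (Fin d)))) :=
    ⟨by simpa using hΩ.measure_lt_top⟩
  have : Nonempty (Fin d) := ⟨⟨0, hd⟩⟩
  have : Infinite Ω := by
    obtain ⟨x, hx⟩ := hne
    exact (infinite_of_mem_nhds x (Ω.isOpen.mem_nhds hx)).to_subtype
  -- Indicators of infinitely many disjoint nonempty open sets are orthogonal and nonzero. Positive
  -- dimension enters in `Infinite Ω`.
  obtain ⟨U, hUi, hUo, hUd⟩ := exists_seq_infinite_isOpen_pairwise_disjoint Ω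
  have hVo : ∀ n, IsOpen (Subtype.val '' U n) := fun n =>
    Ω.isOpen.isOpenEmbedding_subtypeVal.isOpenMap _ (hUo n)
  let f : ℕ → L2 Ω := fun n => indicatorConstLp 2
    (μ := volume.restrict (Ω : Set (EuclideanSpace ℝ (Fin d))))
    (hVo n).measurableSet (measure_ne_top _ _) (1 : ℝ)
  have hinner : ∀ i j, inner ℝ (f i) (f j) =
      volume.real (Subtype.val '' U i ∩ Subtype.val '' U j) := fun i j => by
    rw [L2.real_inner_indicatorConstLp_one_indicatorConstLp_one, measureReal_restrict_apply
      ((hVo i).inter (hVo j)).measurableSet, Set.inter_eq_left.2]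
    rintro _ ⟨⟨x, -, rfl⟩, -⟩
    exact x.2
  have hli : LinearIndependent ℝ f := by
    refine linearIndependent_of_ne_zero_of_inner_eq_zero (𝕜 := ℝ) (fun n h0 => ?_) fun i j hij => ?_
    · have h1 := hinner n n
      rw [h0, inner_zero_left, Set.inter_self] at h1
      have h2 : 0 < volume (Subtype.val '' U n) :=
        (hVo n).measure_pos _ ((hUi n).nonempty.image _)
      have h3 : volume (Subtype.val '' U n) < ∞ := by
        refine (measure_mono ?_).trans_lt hΩ.measure_lt_top
        rintro _ ⟨x, -, rfl⟩
        exact x.2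
      exact (ENNReal.toReal_pos h2.ne' h3.ne).ne h1
    · change inner ℝ (f i) (f j) = 0
      rw [hinner, ← Set.image_inter Subtype.val_injective, (hUd hij).inter_eq]
      simp
  intro hfd
  exact not_finite_iff_infinite.2 inferInstance hli.finite

/-- An orthonormal basis of eigenfunctions of the Dirichlet Laplacian of a bounded open set. -/
theorem exists_dirichlet_eigenbasis (hd : 1 ≤ d)
    (hne : (Ω : Set (EuclideanSpace ℝ (Fin d))).Nonempty)
    (hΩ : Bornology.IsBounded (Ω : Set (EuclideanSpace ℝ (Fin d)))) :
    ∃ (ι : Type) (e : HilbertBasis ι ℝ (L2 Ω)) (lam : ι → ℝ), (∀ i, 0 ≤ lam i) ∧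
      (∀ u f, HasDirichletLaplacian Ω u f ↔
        ∀ i, inner ℝ (e i) f = -lam i * inner ℝ (e i) u) ∧
      ∀ C, ∃ i, C < lam i := by
  have hK := isCompactOperator_resolvent hΩ
  obtain ⟨ι, e, μ, hμ⟩ := exists_hilbertBasis_eigenvectors hK (isSymmetric_resolvent (Ω := Ω))
  have he : ∀ i, ‖e i‖ = 1 := e.orthonormal.1
  have he0 : ∀ i, e i ≠ 0 := fun i => by
    rw [← norm_ne_zero_iff, he]; exact one_ne_zero
  have hpos : ∀ i, 0 < μ i := fun i => by
    have h1 : 0 ≤ inner ℝ (resolvent Ω (e i)) (e i) := by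
      rw [inner_resolvent_self]; positivity
    rw [hμ, real_inner_smul_left, real_inner_self_eq_norm_sq, he] at h1
    refine lt_of_le_of_ne (by simpa using h1) fun h0 => he0 i (eq_zero_of_resolvent_eq_zero ?_)
    rw [hμ, ← h0, zero_smul]
  have hle : ∀ i, μ i ≤ 1 := fun i => by
    have := norm_resolvent_le (e i)
    rw [hμ, norm_smul, he, mul_one] at this
    exact (le_abs_self _).trans this
  have hcoord : ∀ x i, inner ℝ (e i) (resolvent Ω x) = μ i * inner ℝ (e i) x := fun x i => by
    have := isSymmetric_resolvent (Ω := Ω) (e i) x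
    change inner ℝ (resolvent Ω (e i)) x = inner ℝ (e i) (resolvent Ω x) at this
    rw [← this, hμ, real_inner_smul_left]
  -- The resolvent is `(1 - Δ)⁻¹`, so `μ = 1 / (1 + λ)`; the bound `μ ≤ 1` becomes `λ ≥ 0`.
  refine ⟨ι, e, fun i => (μ i)⁻¹ - 1, fun i => ?_, fun u f => ?_, fun C => ?_⟩
  · simpa using (one_le_inv₀ (hpos i)).2 (hle i)
  · rw [hasDirichletLaplacian_iff]
    have hi : ∀ i, inner ℝ (e i) u = inner ℝ (e i) (resolvent Ω (u - f)) ↔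
        inner ℝ (e i) f = -((μ i)⁻¹ - 1) * inner ℝ (e i) u := fun i => by
      rw [hcoord, inner_sub_right]
      have := (hpos i).ne'
      field_simp
      constructor <;> intro h <;> linarith
    exact ⟨fun h i => (hi i).1 (congrArg _ h), fun h => ext_of_inner e fun i => (hi i).2 (h i)⟩
  -- With this threshold `(μ i)⁻¹ > |C| + 2`, which leaves room for the shift by `1`.
  · obtain ⟨i, hi⟩ := exists_eigenvalue_lt hK (not_finiteDimensional_L2 hd hne hΩ) e hcoord
      (δ := (|C| + 2)⁻¹) (by positivity)
    refine ⟨i, ?_⟩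
    have := (lt_inv_comm₀ (hpos i) (by positivity)).1 hi
    linarith [le_abs_self C]

/-! ### Strongly continuous semigroups and classical solutions -/

theorem nnreal_map_nhdsGT_zero :
    map ((↑) : ℝ≥0 → ℝ) (𝓝[>] 0) = 𝓝[>] (0 : ℝ) := by
  rw [NNReal.isEmbedding_coe.map_nhdsWithin_eq, NNReal.coe_zero]
  congr 1
  ext x
  constructor
  · rintro ⟨y, hy, rfl⟩
    exact NNReal.coe_pos.2 hy
  · intro hx
    exact ⟨⟨x, le_of_lt hx⟩, hx, rfl⟩

section Semigroup

variable {X : Type*} [NormedAddCommGroup X] [NormedSpace ℝ X]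

theorem tendsto_generator_iff {S : ℝ≥0 → X →L[ℝ] X} (h0 : S 0 = ContinuousLinearMap.id ℝ X)
    (x y : X) :
    Tendsto (fun h : ℝ≥0 => (h : ℝ)⁻¹ • (S h x - x)) (𝓝[>] 0) (𝓝 y) ↔
      HasDerivWithinAt (fun t : ℝ => S t.toNNReal x) y (Set.Ici 0) 0 := by
  rw [← hasDerivWithinAt_Ioi_iff_Ici, hasDerivWithinAt_iff_tendsto_slope' (by simp),
    ← nnreal_map_nhdsGT_zero, tendsto_map'_iff]
  refine tendsto_congr fun h => ?_
  simp [slope, h0]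

theorem exists_norm_le_of_isC0Semigroup [CompleteSpace X] {S : ℝ≥0 → X →L[ℝ] X}
    (hS : IsC0Semigroup S) (t : ℝ≥0) : ∃ M : ℝ, ∀ r ≤ t, ‖S r‖ ≤ M := by
  obtain ⟨M, hM⟩ := banach_steinhaus (g := fun r : Set.Icc 0 t => S r) fun x => by
    obtain ⟨C, hC⟩ := isCompact_Icc.exists_bound_of_continuousOn
      (hS.continuous_orbit x).continuousOn (s := Set.Icc 0 t)
    exact ⟨C, fun r => hC r r.2⟩
  exact ⟨M, fun r hr => hM ⟨r, zero_le, hr⟩⟩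

/-- Classical solutions of `u' = G u` are given by the semigroup that `G` generates. -/
theorem semigroup_apply_eq_of_hasDerivAt [CompleteSpace X] {G : X → X → Prop}
    {S : ℝ≥0 → X →L[ℝ] X} (hS : IsSemigroupGeneratedBy G S) {u u' : ℝ → X}
    (hu : ∀ t, HasDerivAt u (u' t) t) (hG : ∀ t, G (u t) (u' t)) (t : ℝ≥0) :
    S t (u 0) = u t := by
  have hC := hS.isC0Semigroup
  obtain ⟨M, hM⟩ := exists_norm_le_of_isC0Semigroup hC t
  have hbound : ∀ s : ℝ, 0 ≤ s → ∀ x, ‖S ((t : ℝ) - s).toNNReal x‖ ≤ M * ‖x‖ := fun s hs x =>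
    ContinuousLinearMap.le_of_opNorm_le _ (hM _ (Real.toNNReal_le_iff_le_coe.2 (by linarith))) x
  -- The function `s ↦ S (t - s) (u s)` equals `S t (u 0)` at `0` and `u t` at `t`. It is constant,
  -- being continuous with zero right derivative; only right derivatives are available from the
  -- generator.
  have hcont : ContinuousOn (fun s : ℝ => S ((t : ℝ) - s).toNNReal (u s)) (Set.Icc 0 t) := by
    intro s₀ _
    have h1 : Tendsto (fun s : ℝ => S ((t : ℝ) - s).toNNReal (u s - u s₀))
        (𝓝[Set.Icc 0 (t : ℝ)] s₀) (𝓝 0) := by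
      refine squeeze_zero_norm' (a := fun s => M * ‖u s - u s₀‖) ?_ ?_
      · filter_upwards [self_mem_nhdsWithin] with s hs
        exact hbound s hs.1 _
      · have : Tendsto (fun s => M * ‖u s - u s₀‖) (𝓝 s₀) (𝓝 (M * ‖u s₀ - u s₀‖)) :=
          (((hu s₀).continuousAt.sub continuousAt_const).norm.const_mul M).tendsto
        simp only [sub_self, norm_zero, mul_zero] at this
        exact this.mono_left nhdsWithin_le_nhds
    have h2 : Tendsto (fun s : ℝ => S ((t : ℝ) - s).toNNReal (u s₀))
        (𝓝[Set.Icc 0 (t : ℝ)] s₀) (𝓝 (S ((t : ℝ) - s₀).toNNReal (u s₀))) := by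
      have : Continuous fun s : ℝ => S ((t : ℝ) - s).toNNReal (u s₀) :=
        (hC.continuous_orbit (u s₀)).comp
          (continuous_real_toNNReal.comp (continuous_const.sub continuous_id))
      exact this.continuousWithinAt
    simpa [ContinuousWithinAt] using h1.add h2
  have hderiv : ∀ s ∈ Set.Ico (0 : ℝ) t,
      HasDerivWithinAt (fun s : ℝ => S ((t : ℝ) - s).toNNReal (u s)) 0 (Set.Ici s) s := by
    intro s hs
    have h1 : HasDerivWithinAt (fun r : ℝ => S (r - s).toNNReal (u s)) (u' s) (Set.Ici s) s := by
      have h2 := (tendsto_generator_iff hC.map_zero (u s) (u' s)).1 ((hS.generator_iff _ _).1 (hG s))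
      have h3 := HasDerivWithinAt.scomp_of_eq (h := fun r => r - s) s h2
        (((hasDerivAt_id s).sub_const s).hasDerivWithinAt (s := Set.Ici s))
        (fun r (hr : s ≤ r) => sub_nonneg.2 hr) (sub_self s).symm
      rw [one_smul] at h3
      exact h3
    -- Both `u r` and `S (r - s) (u s)` start at `u s` with right derivative `u' s`, so they differ
    -- by `o(r - s)`. Applying `S (t - r)`, bounded by `M`, turns this difference into the increment
    -- to be estimated.
    have h4 := (hu s).hasDerivWithinAt (s := Set.Ici s) |>.sub h1
    rw [sub_self, hasDerivWithinAt_iff_isLittleO] at h4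
    rw [hasDerivWithinAt_iff_isLittleO]
    refine Asymptotics.IsBigO.trans_isLittleO (Asymptotics.IsBigO.of_bound M ?_) h4
    have hev : ∀ᶠ r : ℝ in 𝓝[Set.Ici s] s, r < (t : ℝ) := nhdsWithin_le_nhds (eventually_lt_nhds hs.2)
    filter_upwards [self_mem_nhdsWithin, hev] with r hr hrt
    have hr' : s ≤ r := hr
    have hsplit : ((t : ℝ) - s).toNNReal = ((t : ℝ) - r).toNNReal + (r - s).toNNReal := by
      rw [← Real.toNNReal_add (by linarith) (by linarith)]
      congr 1
      ring
    have := hbound r (hs.1.trans hr') (u r - S (r - s).toNNReal (u s))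
    rw [hsplit, hC.map_add, ContinuousLinearMap.comp_apply, smul_zero, sub_zero, ← map_sub]
    simpa [hC.map_zero] using this
  have := constant_of_has_deriv_right_zero hcont hderiv t ⟨t.2, le_rfl⟩
  simpa [hC.map_zero] using this.symm

end Semigroup

/-! ### Damped rotations and the semigroup they form -/

/-- A coordinate of the solution of `z' = -l (a, -b; b, a) z` with `z(0) = (p, q)`. -/
noncomputable def rot (a b l p q t : ℝ) : ℝ :=
  Real.exp (-(a * l * t)) * (Real.cos (b * l * t) * p + Real.sin (b * l * t) * q)

theorem rot_zero (a b l p q : ℝ) : rot a b l p q 0 = p := by simp [rot]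

/-- The flow commutes with its generator, so the derivative is the same flow started from the
generator's value. In this form it serves both as an antiderivative formula and as the evolution
equation. -/
theorem hasDerivAt_rot (a b l p q t : ℝ) :
    HasDerivAt (rot a b l p q) (rot a b l (-l * (a * p - b * q)) (-l * (b * p + a * q)) t) t := by
  have h1 : HasDerivAt (fun t : ℝ => -(a * l * t)) (-(a * l)) t := by
    have h := (hasDerivAt_id t).const_mul (-(a * l))
    simp only [neg_mul, mul_one, id] at h
    exact h
  have h2 : HasDerivAt (fun t : ℝ => b * l * t) (b * l) t := by
    simpa using (hasDerivAt_id t).const_mul (b * l)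
  refine (h1.exp.mul ((h2.cos.mul_const p).add (h2.sin.mul_const q))).congr_deriv ?_
  simp only [rot, Pi.add_apply]
  ring

theorem continuous_rot (a b l p q : ℝ) : Continuous (rot a b l p q) :=
  continuous_iff_continuousAt.2 fun t => (hasDerivAt_rot a b l p q t).continuousAt

section Coupled

variable {ι H : Type*} [NormedAddCommGroup H] [InnerProductSpace ℝ H]

/-- The operator `(C, D; -D, C)`. -/
noncomputable def coupled (C D : H →L[ℝ] H) : WithLp 2 (H × H) →L[ℝ] WithLp 2 (H × H) :=
  ((WithLp.prodContinuousLinearEquiv 2 ℝ H H).symm : H × H →L[ℝ] WithLp 2 (H × H)) ∘L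
    ((C ∘L ContinuousLinearMap.fst ℝ H H + D ∘L ContinuousLinearMap.snd ℝ H H).prod
      (C ∘L ContinuousLinearMap.snd ℝ H H - D ∘L ContinuousLinearMap.fst ℝ H H)) ∘L
    (WithLp.prodContinuousLinearEquiv 2 ℝ H H : WithLp 2 (H × H) →L[ℝ] H × H)

theorem pair_ext (e : HilbertBasis ι ℝ H) {x y : WithLp 2 (H × H)}
    (h1 : ∀ i, inner ℝ (e i) x.fst = inner ℝ (e i) y.fst)
    (h2 : ∀ i, inner ℝ (e i) x.snd = inner ℝ (e i) y.snd) : x = y :=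
  WithLp.ofLp_injective 2 (Prod.ext (ext_of_inner e h1) (ext_of_inner e h2))

/-- `S` solves `z' = -l (a, -b; b, a) z` in each coordinate of the basis `e`. -/
def IsRotation (e : HilbertBasis ι ℝ H) (lam : ι → ℝ) (a b : ℝ)
    (S : ℝ≥0 → WithLp 2 (H × H) →L[ℝ] WithLp 2 (H × H)) : Prop :=
  ∀ t x i,
    inner ℝ (e i) (S t x).fst = rot a b (lam i) (inner ℝ (e i) x.fst) (inner ℝ (e i) x.snd) t ∧
    inner ℝ (e i) (S t x).snd = rot a b (lam i) (inner ℝ (e i) x.snd) (-inner ℝ (e i) x.fst) t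

theorem exists_isRotation (e : HilbertBasis ι ℝ H) {lam : ι → ℝ} (hlam : ∀ i, 0 ≤ lam i)
    {a : ℝ} (ha : 0 ≤ a) (b : ℝ) :
    ∃ S : ℝ≥0 → WithLp 2 (H × H) →L[ℝ] WithLp 2 (H × H),
      IsC0Semigroup S ∧ IsRotation e lam a b S := by
  have hexp : ∀ (t : ℝ≥0) i, Real.exp (-(a * lam i * t)) ≤ 1 := fun t i =>
    Real.exp_le_one_iff.2 (neg_nonpos.2 (mul_nonneg (mul_nonneg ha (hlam i)) t.2))
  choose C hC hCe using fun t : ℝ≥0 => exists_diagonal e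
    (fun i => Real.exp (-(a * lam i * t)) * Real.cos (b * lam i * t)) fun i => by
      rw [abs_mul, Real.abs_exp]
      exact mul_le_one₀ (hexp t i) (abs_nonneg _) (Real.abs_cos_le_one _)
  choose D hD hDe using fun t : ℝ≥0 => exists_diagonal e
    (fun i => Real.exp (-(a * lam i * t)) * Real.sin (b * lam i * t)) fun i => by
      rw [abs_mul, Real.abs_exp]
      exact mul_le_one₀ (hexp t i) (abs_nonneg _) (Real.abs_sin_le_one _)
  have hrot : IsRotation e lam a b fun t => coupled (C t) (D t) := by
    intro t x i
    constructor
    · change inner ℝ (e i) (C t x.fst + D t x.snd) = _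
      rw [inner_add_right, hCe, hDe, rot]
      ring
    · change inner ℝ (e i) (C t x.snd - D t x.fst) = _
      rw [inner_sub_right, hCe, hDe, rot]
      ring
  refine ⟨_, ⟨?_, fun s t => ?_, fun x => ?_⟩, hrot⟩
  · refine ContinuousLinearMap.ext fun x => pair_ext e (fun i => ?_) fun i => ?_
    · rw [(hrot 0 x i).1, NNReal.coe_zero, rot_zero]; rfl
    · rw [(hrot 0 x i).2, NNReal.coe_zero, rot_zero]; rfl
  · refine ContinuousLinearMap.ext fun x => pair_ext e (fun i => ?_) fun i => ?_
    · rw [(hrot _ x i).1, ContinuousLinearMap.comp_apply, (hrot s _ i).1, (hrot t x i).1,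
        (hrot t x i).2]
      simp only [rot, NNReal.coe_add, mul_add, neg_add, Real.exp_add, Real.cos_add, Real.sin_add]
      ring
    · rw [(hrot _ x i).2, ContinuousLinearMap.comp_apply, (hrot s _ i).2, (hrot t x i).1,
        (hrot t x i).2]
      simp only [rot, NNReal.coe_add, mul_add, neg_add, Real.exp_add, Real.cos_add, Real.sin_add]
      ring
  · have hCc : ∀ x, Continuous fun t => C t x := continuous_diagonal e (fun i => by fun_prop) hC hCe
    have hDc : ∀ x, Continuous fun t => D t x := continuous_diagonal e (fun i => by fun_prop) hD hDe
    exact (WithLp.prodContinuousLinearEquiv 2 ℝ H H).symm.continuous.comp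
      (((hCc _).add (hDc _)).prodMk ((hCc _).sub (hDc _)))

variable [CompleteSpace H]

/-- A derivative of the orbit can be read off coordinate by coordinate. Conversely, coordinate
relations alone do not give convergence in norm; that comes from the integral identity `S t x = x +
∫ S s y`, which is checked in coordinates and then differentiated at `0`. -/
theorem tendsto_generator_iff_of_isRotation {e : HilbertBasis ι ℝ H} {lam : ι → ℝ} {a b : ℝ}
    {S : ℝ≥0 → WithLp 2 (H × H) →L[ℝ] WithLp 2 (H × H)} (hS : IsC0Semigroup S)
    (hrot : IsRotation e lam a b S) (x y : WithLp 2 (H × H)) :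
    Tendsto (fun h : ℝ≥0 => (h : ℝ)⁻¹ • (S h x - x)) (𝓝[>] 0) (𝓝 y) ↔
      ∀ i, inner ℝ (e i) y.fst =
          -lam i * (a * inner ℝ (e i) x.fst - b * inner ℝ (e i) x.snd) ∧
        inner ℝ (e i) y.snd =
          -lam i * (b * inner ℝ (e i) x.fst + a * inner ℝ (e i) x.snd) := by
  rw [tendsto_generator_iff hS.map_zero]
  let P : ι → WithLp 2 (H × H) →L[ℝ] ℝ := fun i => innerSL ℝ (e i) ∘L WithLp.fstL 2 ℝ H H
  let Q : ι → WithLp 2 (H × H) →L[ℝ] ℝ := fun i => innerSL ℝ (e i) ∘L WithLp.sndL 2 ℝ H H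
  have hP : ∀ i (t : ℝ), 0 ≤ t → ∀ x, P i (S t.toNNReal x) =
      rot a b (lam i) (inner ℝ (e i) x.fst) (inner ℝ (e i) x.snd) t := fun i t ht x =>
    ((hrot _ x i).1).trans (by rw [Real.coe_toNNReal _ ht])
  have hQ : ∀ i (t : ℝ), 0 ≤ t → ∀ x, Q i (S t.toNNReal x) =
      rot a b (lam i) (inner ℝ (e i) x.snd) (-inner ℝ (e i) x.fst) t := fun i t ht x =>
    ((hrot _ x i).2).trans (by rw [Real.coe_toNNReal _ ht])
  constructor
  · intro h i
    constructor
    · have h1 := (P i).hasFDerivAt.comp_hasDerivWithinAt 0 h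
      have h2 := ((hasDerivAt_rot a b (lam i) (inner ℝ (e i) x.fst) (inner ℝ (e i) x.snd)
        0).hasDerivWithinAt (s := Set.Ici 0)).congr (fun t ht => hP i t ht x) (hP i 0 le_rfl x)
      rw [rot_zero] at h2
      exact (uniqueDiffOn_Ici (0 : ℝ) 0 Set.self_mem_Ici).eq_deriv _ h1 h2
    · have h1 := (Q i).hasFDerivAt.comp_hasDerivWithinAt 0 h
      have h2 := ((hasDerivAt_rot a b (lam i) (inner ℝ (e i) x.snd) (-inner ℝ (e i) x.fst)
        0).hasDerivWithinAt (s := Set.Ici 0)).congr (fun t ht => hQ i t ht x) (hQ i 0 le_rfl x)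
      rw [rot_zero] at h2
      refine ((uniqueDiffOn_Ici (0 : ℝ) 0 Set.self_mem_Ici).eq_deriv _ h1 h2).trans ?_
      ring
  · intro h
    have hc : Continuous fun s : ℝ => S s.toNNReal y :=
      (hS.continuous_orbit y).comp continuous_real_toNNReal
    have hI : ∀ t : ℝ, 0 ≤ t → S t.toNNReal x = x + ∫ s in (0 : ℝ)..t, S s.toNNReal y := by
      intro t ht
      refine pair_ext e (fun i => ?_) fun i => ?_
      · change P i (S t.toNNReal x) = P i (x + ∫ s in (0 : ℝ)..t, S s.toNNReal y)
        rw [hP i t ht, map_add, ← (P i).intervalIntegral_comp_comm (hc.intervalIntegrable _ _)]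
        rw [intervalIntegral.integral_congr (g := rot a b (lam i) (inner ℝ (e i) y.fst)
          (inner ℝ (e i) y.snd)) fun s hs => hP i s (by rw [Set.uIcc_of_le ht] at hs; exact hs.1) y]
        rw [(h i).1, (h i).2, intervalIntegral.integral_eq_sub_of_hasDerivAt
          (fun s _ => hasDerivAt_rot a b (lam i) (inner ℝ (e i) x.fst) (inner ℝ (e i) x.snd) s)
          ((continuous_rot _ _ _ _ _).intervalIntegrable _ _), rot_zero]
        exact (add_sub_cancel (inner ℝ (e i) x.fst) _).symm
      · change Q i (S t.toNNReal x) = Q i (x + ∫ s in (0 : ℝ)..t, S s.toNNReal y)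
        rw [hQ i t ht, map_add, ← (Q i).intervalIntegral_comp_comm (hc.intervalIntegrable _ _)]
        rw [intervalIntegral.integral_congr (g := rot a b (lam i) (inner ℝ (e i) y.snd)
          (-inner ℝ (e i) y.fst)) fun s hs => hQ i s (by rw [Set.uIcc_of_le ht] at hs; exact hs.1) y]
        have h1 : inner ℝ (e i) y.snd =
            -lam i * (a * inner ℝ (e i) x.snd - b * -inner ℝ (e i) x.fst) := by
          rw [(h i).2]; ring
        have h2 : -inner ℝ (e i) y.fst =
            -lam i * (b * inner ℝ (e i) x.snd + a * -inner ℝ (e i) x.fst) := by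
          rw [(h i).1]; ring
        rw [h1, h2, intervalIntegral.integral_eq_sub_of_hasDerivAt
          (fun s _ => hasDerivAt_rot a b (lam i) (inner ℝ (e i) x.snd) (-inner ℝ (e i) x.fst) s)
          ((continuous_rot _ _ _ _ _).intervalIntegrable _ _), rot_zero]
        exact (add_sub_cancel (inner ℝ (e i) x.snd) _).symm
    have hd : HasDerivAt (fun t : ℝ => x + ∫ s in (0 : ℝ)..t, S s.toNNReal y) y 0 := by
      have := (hc.integral_hasStrictDerivAt 0 0).hasDerivAt.const_add x
      simpa [hS.map_zero] using this
    exact hd.hasDerivWithinAt.congr (fun t ht => hI t ht) (hI 0 le_rfl)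

end Coupled

/-! ### The coupled Laplacian, its eigenmodes and uniqueness -/

theorem HasDirichletLaplacian.smul {u f : L2 Ω} (h : HasDirichletLaplacian Ω u f) (r : ℝ) :
    HasDirichletLaplacian Ω (r • u) (r • f) := by
  rw [hasDirichletLaplacian_iff] at h ⊢
  rw [← smul_sub, map_smul, ← h]

/-- The matrix `(a, -b; b, a)` has determinant `a² + b² ≠ 0`. Its inverse recovers the two
Laplacians from `w`, so the coordinate relations already force both components into the domain of
`Δ`. -/
theorem hasCoupledLaplacian_iff {ι : Type*} {e : HilbertBasis ι ℝ (L2 Ω)} {lam : ι → ℝ}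
    (hL : ∀ u f, HasDirichletLaplacian Ω u f ↔ ∀ i, inner ℝ (e i) f = -lam i * inner ℝ (e i) u)
    {a : ℝ} (ha : 0 < a) (b : ℝ) (z w : State Ω) :
    HasCoupledLaplacian Ω a b z w ↔
      ∀ i, inner ℝ (e i) w.fst =
          -lam i * (a * inner ℝ (e i) z.fst - b * inner ℝ (e i) z.snd) ∧
        inner ℝ (e i) w.snd =
          -lam i * (b * inner ℝ (e i) z.fst + a * inner ℝ (e i) z.snd) := by
  constructor
  · rintro ⟨f₁, f₂, h1, h2, rfl⟩ i
    have h3 := (hL _ _).1 h1 i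
    have h4 := (hL _ _).1 h2 i
    constructor
    · change inner ℝ (e i) (a • f₁ - b • f₂) = _
      rw [inner_sub_right, real_inner_smul_right, real_inner_smul_right, h3, h4]
      ring
    · change inner ℝ (e i) (b • f₁ + a • f₂) = _
      rw [inner_add_right, real_inner_smul_right, real_inner_smul_right, h3, h4]
      ring
  · intro h
    have hr : a ^ 2 + b ^ 2 ≠ 0 := by positivity
    refine ⟨(a ^ 2 + b ^ 2)⁻¹ • (a • w.fst + b • w.snd),
      (a ^ 2 + b ^ 2)⁻¹ • (a • w.snd - b • w.fst), ?_, ?_, ?_⟩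
    · rw [hL]
      intro i
      rw [real_inner_smul_right, inner_add_right, real_inner_smul_right, real_inner_smul_right,
        (h i).1, (h i).2]
      field_simp
      ring
    · rw [hL]
      intro i
      rw [real_inner_smul_right, inner_sub_right, real_inner_smul_right, real_inner_smul_right,
        (h i).1, (h i).2]
      field_simp
      ring
    · refine WithLp.ofLp_injective 2 (Prod.ext ?_ ?_)
      · change w.fst = a • (a ^ 2 + b ^ 2)⁻¹ • (a • w.fst + b • w.snd) -
          b • (a ^ 2 + b ^ 2)⁻¹ • (a • w.snd - b • w.fst)
        match_scalars <;> field_simp <;> ring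
      · change w.snd = b • (a ^ 2 + b ^ 2)⁻¹ • (a • w.fst + b • w.snd) +
          a • (a ^ 2 + b ^ 2)⁻¹ • (a • w.snd - b • w.fst)
        match_scalars <;> field_simp <;> ring

/-- A semigroup generated by the coupled Laplacian acts on an eigenmode by damped rotation. -/
theorem semigroup_eigenmode {a b : ℝ} {S : ℝ≥0 → State Ω →L[ℝ] State Ω}
    (hS : IsSemigroupGeneratedBy (HasCoupledLaplacian Ω a b) S) {lam : ℝ} {e : L2 Ω}
    (he : HasDirichletLaplacian Ω e (-(lam • e))) (p q : ℝ) (t : ℝ≥0) :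
    S t (mkState (p • e) (q • e)) =
      mkState (rot a b lam p q t • e) (rot a b lam q (-p) t • e) := by
  have hu : ∀ t : ℝ, HasDerivAt
      (fun t => mkState (rot a b lam p q t • e) (rot a b lam q (-p) t • e))
      (mkState (rot a b lam (-lam * (a * p - b * q)) (-lam * (b * p + a * q)) t • e)
        (rot a b lam (-lam * (a * q - b * -p)) (-lam * (b * q + a * -p)) t • e)) t := fun t =>
    (WithLp.prodContinuousLinearEquiv 2 ℝ (L2 Ω) (L2 Ω)).symm.hasFDerivAt.comp_hasDerivAt t
      (((hasDerivAt_rot a b lam p q t).smul_const e).prodMk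
        ((hasDerivAt_rot a b lam q (-p) t).smul_const e))
  have h := semigroup_apply_eq_of_hasDerivAt hS hu (fun t => ?_) t
  · simpa only [rot_zero] using h
  · refine ⟨_, _, he.smul _, he.smul _, ?_⟩
    congr 1
    · simp only [rot]
      module
    · simp only [rot]
      module

/-- Both semigroups are given by the same formula on eigenmodes, and these span a dense subspace. -/
theorem semigroup_unique {ι : Type*} (e : HilbertBasis ι ℝ (L2 Ω)) {lam : ι → ℝ}
    (he : ∀ i, HasDirichletLaplacian Ω (e i) (-(lam i • e i))) {a b : ℝ}
    {S R : ℝ≥0 → State Ω →L[ℝ] State Ω}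
    (hS : IsSemigroupGeneratedBy (HasCoupledLaplacian Ω a b) S)
    (hR : IsSemigroupGeneratedBy (HasCoupledLaplacian Ω a b) R) : S = R := by
  funext t
  let J : L2 Ω × L2 Ω →L[ℝ] State Ω :=
    ((WithLp.prodContinuousLinearEquiv 2 ℝ (L2 Ω) (L2 Ω)).symm : L2 Ω × L2 Ω →L[ℝ] State Ω)
  have hmode : ∀ i (p q : ℝ), (S t - R t) (J (p • e i, q • e i)) = 0 := fun i p q => by
    change S t (mkState _ _) - R t (mkState _ _) = 0
    rw [semigroup_eigenmode hS (he i), semigroup_eigenmode hR (he i), sub_self]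
  have h1 : ∀ x, (S t - R t) (J (x, 0)) = 0 := mem_of_basis_mem e
    (((S t - R t) ∘L J ∘L ContinuousLinearMap.inl ℝ _ _).ker) (ContinuousLinearMap.isClosed_ker _)
    fun i => by simpa using hmode i 1 0
  have h2 : ∀ x, (S t - R t) (J (0, x)) = 0 := mem_of_basis_mem e
    (((S t - R t) ∘L J ∘L ContinuousLinearMap.inr ℝ _ _).ker) (ContinuousLinearMap.isClosed_ker _)
    fun i => by simpa using hmode i 0 1
  refine ContinuousLinearMap.ext fun x => sub_eq_zero.1 ?_
  have hx : x = J (x.fst, 0) + J (0, x.snd) := by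
    rw [← map_add, Prod.mk_add_mk, add_zero, zero_add]
    rfl
  change (S t - R t) x = 0
  rw [hx, map_add, h1, h2, add_zero]

theorem mkState_smul_eq_zero {e : L2 Ω} (he : e ≠ 0) {p q : ℝ}
    (h : mkState (p • e) (q • e) = 0) : p = 0 ∧ q = 0 := by
  have h1 : p • e = 0 := congrArg WithLp.fst h
  have h2 : q • e = 0 := congrArg WithLp.snd h
  exact ⟨(smul_eq_zero.1 h1).resolve_right he, (smul_eq_zero.1 h2).resolve_right he⟩

/-- Rotation preserves the planar norm, so only the damping remains; in particular a nonzero mode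
never reaches zero. -/
theorem rot_sq_add_rot_sq (a b l p q t : ℝ) :
    rot a b l p q t ^ 2 + rot a b l q (-p) t ^ 2 =
      Real.exp (-(a * l * t)) ^ 2 * (p ^ 2 + q ^ 2) := by
  simp only [rot]
  linear_combination Real.exp (-(a * l * t)) ^ 2 * (p ^ 2 + q ^ 2) *
    Real.sin_sq_add_cos_sq (b * l * t)

/-- Since `1 - θ > 0`, a vanishing sum of observations makes the right side zero for every `C`. -/
theorem not_interpolationObservability {S : ℝ≥0 → State Ω →L[ℝ] State Ω} {T : ℝ≥0} {m : ℕ}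
    {τ : Fin m → ℝ≥0} {z : State Ω} (hz : ∀ i, observe (S (τ i) z) = 0) (hT : S T z ≠ 0)
    {ω : Fin m → Set (EuclideanSpace ℝ (Fin d))}
    (hω : ∀ i, ω i ⊆ (Ω : Set (EuclideanSpace ℝ (Fin d)))) (p : ℝ≥0∞) {θ : ℝ} (hθ : θ < 1) (C : ℝ) :
    ¬ InterpolationObservability S T τ ω p θ C := by
  intro h
  have h1 := h z
  have h2 : ∀ i, eLpNorm (observe (S (τ i) z)) p (volume.restrict (ω i)) = 0 := fun i => by
    rw [hz i, eLpNorm_congr_ae (ae_restrict_of_ae_restrict_of_subset (hω i) (Lp.coeFn_zero ℝ 2 _))]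
    exact eLpNorm_zero
  simp only [h2, ENNReal.toReal_zero, Finset.sum_const_zero] at h1
  rw [Real.zero_rpow (by linarith), mul_zero, zero_mul] at h1
  exact hT (norm_le_zero_iff.1 h1)

end StronglyCoupled

theorem proposition3p5 {d : ℕ} (hd : 1 ≤ d)
    (Ω : TopologicalSpace.Opens (EuclideanSpace ℝ (Fin d)))
    (hΩne : (Ω : Set (EuclideanSpace ℝ (Fin d))).Nonempty)
    (hΩbd : Bornology.IsBounded (Ω : Set (EuclideanSpace ℝ (Fin d))))
    (a b : ℝ) (ha : 0 < a) (hb : b ≠ 0) :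
    -- the operator generates one and only one strongly continuous semigroup
    (∃! S : ℝ≥0 → StronglyCoupled.State Ω →L[ℝ] StronglyCoupled.State Ω,
      StronglyCoupled.IsSemigroupGeneratedBy (StronglyCoupled.HasCoupledLaplacian Ω a b) S) ∧
    ∀ S : ℝ≥0 → StronglyCoupled.State Ω →L[ℝ] StronglyCoupled.State Ω,
      StronglyCoupled.IsSemigroupGeneratedBy (StronglyCoupled.HasCoupledLaplacian Ω a b) S →
    ∀ T : ℝ≥0, 0 < T → ∀ m : ℕ, 1 ≤ m →
    ∃ (τ : Fin m → ℝ≥0) (z : StronglyCoupled.State Ω),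
      -- the times are distinct points of `(0, T)`, and `z` is a nonzero state
      Function.Injective τ ∧ (∀ i, τ i ∈ Set.Ioo 0 T) ∧ z ≠ 0 ∧
      -- the observation of the solution starting at `z` vanishes at all these times
      (∀ i, StronglyCoupled.observe (S (τ i) z) = 0) ∧
      -- `z` is a single eigenmode and the times are spaced by `2π / (b lam)`
      (∃ (lam : ℝ) (e : StronglyCoupled.L2 Ω) (v₁ v₂ : ℝ),
        0 < lam ∧ StronglyCoupled.IsDirichletEigenfunction Ω lam e ∧
        z = StronglyCoupled.mkState (v₁ • e) (v₂ • e) ∧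
        ∀ i j : Fin m, (τ i : ℝ) - (τ j : ℝ) =
          (((i : ℕ) : ℝ) - ((j : ℕ) : ℝ)) * (2 * Real.pi / (b * lam))) ∧
      -- no interpolation observability inequality holds at these times
      (∀ ω : Fin m → Set (EuclideanSpace ℝ (Fin d)),
        (∀ i, ω i ⊆ (Ω : Set (EuclideanSpace ℝ (Fin d))) ∧ NullMeasurableSet (ω i) volume ∧
          0 < volume (ω i)) →
        ∀ p : ℝ≥0∞, 1 ≤ p → p ≤ 2 → ∀ θ : ℝ, θ ∈ Set.Ioo (0 : ℝ) 1 →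
        ¬ ∃ C : ℝ, 0 < C ∧
          StronglyCoupled.InterpolationObservability S T τ ω p θ C) := by
  obtain ⟨ι, e, lam, hlam, hL, hunb⟩ := StronglyCoupled.exists_dirichlet_eigenbasis hd hΩne hΩbd
  have he : ∀ i, StronglyCoupled.HasDirichletLaplacian Ω (e i) (-(lam i • e i)) := fun i => by
    rw [hL]
    intro j
    rw [inner_neg_right, real_inner_smul_right]
    by_cases hij : j = i
    · rw [hij, neg_mul]
    · rw [e.orthonormal.2 hij, mul_zero, mul_zero, neg_zero]
  refine ⟨?_, fun S hS T hT m hm => ?_⟩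
  · obtain ⟨S, hS, hrot⟩ := StronglyCoupled.exists_isRotation e hlam ha.le b
    have hgen : StronglyCoupled.IsSemigroupGeneratedBy
        (StronglyCoupled.HasCoupledLaplacian Ω a b) S :=
      ⟨hS, fun x y => (StronglyCoupled.hasCoupledLaplacian_iff hL ha b x y).trans
        (StronglyCoupled.tendsto_generator_iff_of_isRotation hS hrot x y).symm⟩
    exact ⟨S, hgen, fun R hR => StronglyCoupled.semigroup_unique e he hR hgen⟩
  have hT' : (0 : ℝ) < T := NNReal.coe_pos.2 hT
  have hm' : (0 : ℝ) < m := Nat.cast_pos.2 hm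
  have hb' : 0 < |b| := abs_pos.2 hb
  -- The eigenvalue is taken so large that `m` full turns last less than `T / 2`.
  obtain ⟨k, hk⟩ := hunb (m * (2 * Real.pi) / (|b| * (T / 2)))
  have hl : 0 < lam k := lt_of_le_of_lt (by positivity) hk
  have hek : e k ≠ 0 := e.orthonormal.ne_zero k
  set δ : ℝ := 2 * Real.pi / (b * lam k) with hδ
  have hblam : b * lam k ≠ 0 := mul_ne_zero hb hl.ne'
  have hδ0 : δ ≠ 0 := div_ne_zero Real.two_pi_pos.ne' hblam
  have hδm : m * |δ| < T / 2 := by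
    rw [hδ, abs_div, abs_mul b, abs_of_pos Real.two_pi_pos, abs_of_pos hl, ← mul_div_assoc,
      div_lt_iff₀ (by positivity)]
    rw [div_lt_iff₀ (by positivity)] at hk
    linarith
  have hsmall : ∀ i : Fin m, |((i : ℕ) : ℝ) * δ| < T / 2 := fun i => by
    rw [abs_mul, Nat.abs_cast]
    refine lt_of_le_of_lt ?_ hδm
    gcongr
    exact i.2.le
  have hpos : ∀ i : Fin m, 0 < (T : ℝ) / 2 + ((i : ℕ) : ℝ) * δ := fun i => by
    linarith [(abs_lt.1 (hsmall i)).1]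
  -- Starting at the midpoint `T / 2` keeps the times in `(0, T)` for either sign of `b`, hence of
  -- `δ`.
  let τ : Fin m → ℝ≥0 := fun i => ⟨(T : ℝ) / 2 + ((i : ℕ) : ℝ) * δ, (hpos i).le⟩
  have hτ : ∀ i, (τ i : ℝ) = (T : ℝ) / 2 + ((i : ℕ) : ℝ) * δ := fun i => rfl
  -- The angle turned by time `T / 2`. The initial vector `(sin φ, -cos φ)` makes the first
  -- component there `cos φ sin φ - sin φ cos φ = 0`, up to damping.
  set φ : ℝ := b * lam k * (T / 2) with hφ
  have hobs : ∀ i, StronglyCoupled.rot a b (lam k) (Real.sin φ) (-Real.cos φ) (τ i) = 0 := by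
    intro i
    have h1 : b * lam k * (τ i : ℝ) = φ + ((i : ℕ) : ℝ) * (2 * Real.pi) := by
      rw [hτ, hφ, hδ]
      field_simp
    rw [StronglyCoupled.rot, h1, Real.cos_add_nat_mul_two_pi, Real.sin_add_nat_mul_two_pi]
    ring
  have hmode := StronglyCoupled.semigroup_eigenmode hS (he k) (Real.sin φ) (-Real.cos φ)
  have hvanish : ∀ i, StronglyCoupled.observe (S (τ i)
      (StronglyCoupled.mkState (Real.sin φ • e k) (-Real.cos φ • e k))) = 0 := fun i => by
    rw [hmode, hobs, zero_smul]
    rfl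
  have hfinal : S T (StronglyCoupled.mkState (Real.sin φ • e k) (-Real.cos φ • e k)) ≠ 0 := by
    intro h0
    rw [hmode] at h0
    obtain ⟨h1, h2⟩ := StronglyCoupled.mkState_smul_eq_zero hek h0
    have h3 := StronglyCoupled.rot_sq_add_rot_sq a b (lam k) (Real.sin φ) (-Real.cos φ) T
    rw [h1, h2, neg_sq, Real.sin_sq_add_cos_sq] at h3
    have := Real.exp_pos (-(a * lam k * T))
    nlinarith
  refine ⟨τ, StronglyCoupled.mkState (Real.sin φ • e k) (-Real.cos φ • e k), fun i j hij => ?_,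
    fun i => ⟨?_, ?_⟩, fun h0 => hfinal (by rw [h0, map_zero]), hvanish,
    ⟨lam k, e k, Real.sin φ, -Real.cos φ, hl, ⟨hek, he k⟩, rfl, fun i j => ?_⟩,
    fun ω hω p _ _ θ hθ => ?_⟩
  · have h1 := congrArg NNReal.toReal hij
    rw [hτ, hτ] at h1
    exact Fin.ext (Nat.cast_injective (mul_right_cancel₀ hδ0 (add_left_cancel h1)))
  · exact NNReal.coe_pos.1 (hpos i)
  · refine NNReal.coe_lt_coe.1 ?_
    rw [hτ]
    linarith [(abs_lt.1 (hsmall i)).2]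
  · rw [hτ, hτ]
    ring
  · rintro ⟨C, -, hC⟩
    exact StronglyCoupled.not_interpolationObservability hvanish hfinal (fun i => (hω i).1) p hθ.2 C
      hC
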